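/- Let $S_G=\mathbb{C}[p_1,p_2,p_3,p_4,u,v,t_1,t_2,L_{123},L_{124},L_{125},L_{126},L_{135},L_{136},L_{245},L_{246}]$ and $\tilde S_G=\mathbb{C}[p_1,p_2,p_3,p_4,t_1,w,L_{123},L_{124},L_{125},L_{126},L_{135},L_{136},L_{245},L_{246}]$ be polynomial rings. Let $h\colon S_G\to\tilde S_G$ be the $\mathbb{C}$-algebra homomorphism with $$h(u)=wp_1+w^2p_2,\qquad h(v)=wp_3+w^2p_4,\qquad h(t_2)=w^3+t_1w,$$ which fixes the other variables, and let $I_D=\ker h$. Let $D_{ijk}$ be the $3\times3$ minor on the columns $i<j<k$ of the matrix $$\mathsf M=\begin{pmatrix}u&v&-t_2p_2&-t_2p_4&-t_2p_1+t_1u&-t_2p_3+t_1v\\-p_1&-p_3&u+t_1p_2&v+t_1p_4&-t_2p_2&-t_2p_4\\-p_2&-p_4&-p_1&-p_3&u&v\end{pmatrix},$$ and put $$G=L_{123}D_{123}+L_{124}D_{124}+L_{125}D_{125}+L_{126}D_{126}+L_{135}D_{135}+3L_{136}(D_{136}+2D_{145})+3L_{245}(D_{245}+2D_{146})+L_{246}D_{246},$$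 which lies in $I_D$. Let $R_G=S_G/(G)$ and $J_D=I_D/(G)\subset R_G$. Let $R_\Pi=S_G[s_1,s_2,s_3]/(F_1,\dots,F_9)$, the coordinate ring of the affine scheme $\Pi^{15}_{\mathbb A}$, where $$F_{1}=(us_{1} - p_{1}s_{2} - p_{2}s_{3}) - L_{126}(-p_{2}p_{3} + p_{1}p_{4}) - L_{136}(p_{1}^{2} + t_{1}p_{2}^{2} + p_{2}u) - L_{245}(2p_{1}p_{3} + 2t_{1}p_{2}p_{4} + p_{4}u + p_{2}v) - L_{246}(p_{3}^{2} + t_{1}p_{4}^{2} + p_{4}v),$$ $$F_{2}=(vs_{1} - p_{3}s_{2} - p_{4}s_{3}) + L_{125}(-p_{2}p_{3} + p_{1}p_{4}) + L_{135}(p_{1}^{2} + t_{1}p_{2}^{2} + p_{2}u) + L_{136}(2p_{1}p_{3} + 2t_{1}p_{2}p_{4} + p_{4}u + p_{2}v) + L_{245}(p_{3}^{2} + t_{1}p_{4}^{2} + p_{4}v),$$ $$F_{3}=(-t_{2}p_{2}s_{1} + (u + t_{1}p_{2})s_{2} - p_{1}s_{3}) - L_{124}(-p_{2}p_{3} + p_{1}p_{4})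 - L_{136}(t_{2}p_{2}^{2} + p_{1}u) - L_{245}(2t_{2}p_{2}p_{4} + p_{3}u + p_{1}v) - L_{246}(t_{2}p_{4}^{2} + p_{3}v),$$ $$F_{4}=(-t_{2}p_{4}s_{1} + (v + t_{1}p_{4})s_{2} - p_{3}s_{3}) + L_{123}(-p_{2}p_{3} + p_{1}p_{4}) + L_{135}(t_{2}p_{2}^{2} + p_{1}u) + L_{136}(2t_{2}p_{2}p_{4} + p_{3}u + p_{1}v) + L_{245}(t_{2}p_{4}^{2} + p_{3}v),$$ $$F_{5}=(-t_{2}p_{1}s_{1} + (t_{1}p_{1} - t_{2}p_{2})s_{2} + (u + t_{1}p_{2})s_{3}) + L_{123}(p_{1}^{2} + t_{1}p_{2}^{2} + p_{2}u) + L_{124}(p_{1}p_{3} + t_{1}p_{2}p_{4} + p_{2}v) - L_{125}(t_{2}p_{2}^{2} + p_{1}u) - L_{126}(t_{2}p_{2}p_{4} + p_{1}v) - L_{136}(t_{1}p_{2}u - t_{2}p_{1}p_{2} + u^{2}) - L_{245}(t_{1}(p_{4}u + p_{2}v) - t_{2}(p_{2}p_{3} + p_{1}p_{4}) + 2uv)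 - L_{246}(t_{1}p_{4}v - t_{2}p_{3}p_{4} + v^{2}),$$ $$F_{6}=(-t_{2}p_{3}s_{1} + (t_{1}p_{3} - t_{2}p_{4})s_{2} + (v + t_{1}p_{4})s_{3}) + L_{123}(t_{1}p_{2}p_{4} + p_{1}p_{3} + p_{4}u) + L_{124}(p_{3}^{2} + t_{1}p_{4}^{2} + p_{4}v) - L_{125}(t_{2}p_{2}p_{4} + p_{3}u) - L_{126}(t_{2}p_{4}^{2} + p_{3}v) + L_{135}(t_{1}p_{2}u - t_{2}p_{1}p_{2} + u^{2}) + L_{136}(t_{1}(p_{4}u + p_{2}v) - t_{2}(p_{2}p_{3} + p_{1}p_{4}) + 2uv) + L_{245}(t_{1}p_{4}v - t_{2}p_{3}p_{4} + v^{2}),$$ $$F_{7}=(-s_{2}^{2} + s_{1}s_{3}) + ((L_{123}p_{2} + L_{124}p_{4})s_{1} - (L_{125}p_{2} + L_{126}p_{4})s_{2}) + L_{123}(L_{136}p_{2}^{2} + 2L_{245}p_{2}p_{4} + L_{246}p_{4}^{2}) - L_{124}(L_{135}p_{2}^{2} + 2L_{136}p_{2}p_{4} + L_{245}p_{4}^{2})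 - L_{125}(L_{136}p_{1}p_{2} + L_{245}(p_{2}p_{3} + p_{1}p_{4}) + L_{246}p_{3}p_{4}) + L_{126}(L_{135}p_{1}p_{2} + L_{136}(p_{2}p_{3} + p_{1}p_{4}) + L_{245}p_{3}p_{4}) + (L_{135}L_{245} - L_{136}^{2})(-p_{1}^{2} + 2up_{2} + t_{1}p_{2}^{2}) + (L_{135}L_{246} - L_{136}L_{245})(-p_{1}p_{3} + up_{4} + vp_{2} + t_{1}p_{2}p_{4}) + (L_{136}L_{246} - L_{245}^{2})(-p_{3}^{2} + 2vp_{4} + t_{1}p_{4}^{2}),$$ $$F_{8}=(s_{2}s_{3} + t_{1}s_{1}s_{2} - t_{2}s_{1}^{2}) + s_{1}(L_{123}p_{1} + L_{124}p_{3}) - s_{2}(L_{125}p_{1} + L_{126}p_{3}) + L_{123}(L_{136}p_{1}p_{2} + L_{245}(p_{1}p_{4} + p_{3}p_{2}) + L_{246}p_{3}p_{4}) - L_{124}(L_{135}p_{1}p_{2} + L_{136}(p_{1}p_{4} + p_{3}p_{2}) + L_{245}p_{3}p_{4}) - L_{125}(L_{136}p_{1}^{2} + 2L_{245}p_{1}p_{3}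 + L_{246}p_{3}^{2}) + L_{126}(L_{135}p_{1}^{2} + 2L_{136}p_{1}p_{3} + L_{245}p_{3}^{2}) + (-L_{136}^{2} + L_{135}L_{245})(2up_{1} + 2t_{1}p_{1}p_{2} - t_{2}p_{2}^{2}) + (L_{135}L_{246} - L_{136}L_{245})((vp_{1} + up_{3}) + t_{1}(p_{1}p_{4} + p_{3}p_{2}) - t_{2}p_{2}p_{4}) + (L_{246}L_{136} - L_{245}^{2})(2vp_{3} + 2t_{1}p_{3}p_{4} - t_{2}p_{4}^{2}),$$ $$F_{9}=(t_{1}s_{2}^{2} + s_{3}^{2} - s_{1}s_{2}t_{2}) + s_{1}(L_{123}u + L_{124}v) - s_{2}(L_{125}u + L_{126}v) + (L_{124}L_{125} - L_{123}L_{126})(-p_{2}p_{3} + p_{1}p_{4}) - L_{123}(L_{246}(p_{3}^{2} + t_{1}p_{4}^{2}) + L_{136}(p_{1}^{2} + t_{1}p_{2}^{2}) + 2L_{245}(p_{1}p_{3} + t_{1}p_{2}p_{4})) + L_{124}(L_{135}(p_{1}^{2} + t_{1}p_{2}^{2}) + 2L_{136}(p_{1}p_{3} + t_{1}p_{2}p_{4})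 + L_{245}(p_{3}^{2} + t_{1}p_{4}^{2})) + L_{125}t_{2}(L_{246}p_{4}^{2} + L_{136}p_{2}^{2} + 2L_{245}p_{2}p_{4}) - L_{126}t_{2}(L_{135}p_{2}^{2} + 2L_{136}p_{2}p_{4} + L_{245}p_{4}^{2}) + (-L_{136}^{2} + L_{135}L_{245})(u^{2} + 2t_{2}p_{1}p_{2}) + (L_{135}L_{246} - L_{136}L_{245})(uv + t_{2}(p_{2}p_{3} + p_{1}p_{4})) + (L_{246}L_{136} - L_{245}^{2})(v^{2} + 2t_{2}p_{3}p_{4}).$$ Then $R_G$ is an integral domain. Let $Q_G$ be its quotient field, let $J_D^{-1}=\{f\in Q_G\mid fJ_D\subset R_G\}$, and let the unprojection ring $R_G[J_D^{-1}]$ be the subring of $Q_G$ generated by $J_D^{-1}$ over $R_G$. There is an isomorphism of $\mathbb{C}$-algebras $$R_\Pi\;\cong\;R_G[J_D^{-1}].$$ It can be chosen so as to send the classes of $L_{136}$ and $L_{245}$ to those of $3L_{136}$ and $3L_{245}$, and the class of every other variable of $S_G$ to the class of the same variable (so it is an isomorphism over $S_G$ up to this rescaling of two coordinates). In particular, $R_\Pi$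 is an integral domain. -/

import Mathlib

namespace Unproj

/-- Names of the 16 coordinates of `S_G`. -/
inductive VarG
  | p1 | p2 | p3 | p4 | u | v | t1 | t2
  | L123 | L124 | L125 | L126 | L135 | L136 | L245 | L246

/-- Names of the 14 coordinates of the normalization ring `S̃_G`. -/
inductive VarN
  | p1 | p2 | p3 | p4 | t1 | w
  | L123 | L124 | L125 | L126 | L135 | L136 | L245 | L246

/-- `S_G = ℂ[p1, …, p4, u, v, t1, t2, L123, …, L246]`. -/
abbrev SG : Type := MvPolynomial VarG ℂ

/-- `S̃_G = ℂ[p1, …, p4, t1, w, L123, …, L246]`. -/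
abbrev SN : Type := MvPolynomial VarN ℂ

/-- `S_Π = S_G[s1, s2, s3]`, where `s1, s2, s3` are the variables with index `0, 1, 2`. -/
abbrev SPi : Type := MvPolynomial (Fin 3) SG

/-- The homomorphism `h : S_G → S̃_G` with `u ↦ w p1 + w² p2`, `v ↦ w p3 + w² p4`,
`t2 ↦ w³ + t1 w` and the other coordinates unchanged. -/
noncomputable def h : SG →ₐ[ℂ] SN :=
  open MvPolynomial in
  aeval fun
    | .p1 => X .p1
    | .p2 => X .p2
    | .p3 => X .p3
    | .p4 => X .p4
    | .u => X .w * X .p1 + X .w ^ 2 * X .p2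
    | .v => X .w * X .p3 + X .w ^ 2 * X .p4
    | .t1 => X .t1
    | .t2 => X .w ^ 3 + X .t1 * X .w
    | .L123 => X .L123
    | .L124 => X .L124
    | .L125 => X .L125
    | .L126 => X .L126
    | .L135 => X .L135
    | .L136 => X .L136
    | .L245 => X .L245
    | .L246 => X .L246

/-- The ideal `I_D = ker h` of the non-normal variety `D`. -/
noncomputable def ID : Ideal SG := RingHom.ker h

/-- The `3 × 6` matrix `M`. -/
def matM {A : Type*} [CommRing A] (p1 p2 p3 p4 u v t1 t2 : A) : Matrix (Fin 3) (Fin 6) A :=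
  !![u, v, -t2 * p2, -t2 * p4, -t2 * p1 + t1 * u, -t2 * p3 + t1 * v;
     -p1, -p3, u + t1 * p2, v + t1 * p4, -t2 * p2, -t2 * p4;
     -p2, -p4, -p1, -p3, u, v]

/-- The `3 × 3` minor of `N` on the columns `i, j, k`, where columns are numbered from `1` to `6`
(in `Fin 6` they are numbered from `0` to `5`). -/
def minor {A : Type*} [CommRing A] (N : Matrix (Fin 3) (Fin 6) A) (i j k : ℕ) : A :=
  (N.submatrix id ![Fin.ofNat 6 (i - 1), Fin.ofNat 6 (j - 1), Fin.ofNat 6 (k - 1)]).det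

/-- The polynomial `G`, in terms of the 16 coordinates. -/
def polyG {A : Type*} [CommRing A] (p1 p2 p3 p4 u v t1 t2
    L123 L124 L125 L126 L135 L136 L245 L246 : A) : A :=
  let D : ℕ → ℕ → ℕ → A := minor (matM p1 p2 p3 p4 u v t1 t2)
  L123 * D 1 2 3 + L124 * D 1 2 4 + L125 * D 1 2 5 + L126 * D 1 2 6
    + L135 * D 1 3 5 + 3 * L136 * (D 1 3 6 + 2 * D 1 4 5)
    + 3 * L245 * (D 2 4 5 + 2 * D 1 4 6) + L246 * D 2 4 6

/-- The nine polynomials `F1, …, F9`, in terms of the 19 coordinates. -/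
def polyF {A : Type*} [CommRing A] (p1 p2 p3 p4 u v t1 t2
    L123 L124 L125 L126 L135 L136 L245 L246 s1 s2 s3 : A) : Fin 9 → A :=
  ![
    -- `F1`
    (u*s1 - p1*s2 - p2*s3) - L126*(-p2*p3 + p1*p4) - L136*(p1^2 + t1*p2^2 + p2*u) -
      L245*(2*p1*p3 + 2*t1*p2*p4 + p4*u + p2*v) - L246*(p3^2 + t1*p4^2 + p4*v),
    -- `F2`
    (v*s1 - p3*s2 - p4*s3) + L125*(-p2*p3 + p1*p4) + L135*(p1^2 + t1*p2^2 + p2*u) +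
      L136*(2*p1*p3 + 2*t1*p2*p4 + p4*u + p2*v) + L245*(p3^2 + t1*p4^2 + p4*v),
    -- `F3`
    (-t2*p2*s1 + (u + t1*p2)*s2 - p1*s3) - L124*(-p2*p3 + p1*p4) - L136*(t2*p2^2 + p1*u) -
      L245*(2*t2*p2*p4 + p3*u + p1*v) - L246*(t2*p4^2 + p3*v),
    -- `F4`
    (-t2*p4*s1 + (v + t1*p4)*s2 - p3*s3) + L123*(-p2*p3 + p1*p4) + L135*(t2*p2^2 + p1*u) +
      L136*(2*t2*p2*p4 + p3*u + p1*v) + L245*(t2*p4^2 + p3*v),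
    -- `F5`
    (-t2*p1*s1 + (t1*p1 - t2*p2)*s2 + (u + t1*p2)*s3) + L123*(p1^2 + t1*p2^2 + p2*u) +
      L124*(p1*p3 + t1*p2*p4 + p2*v) - L125*(t2*p2^2 + p1*u) - L126*(t2*p2*p4 + p1*v) -
      L136*(t1*p2*u - t2*p1*p2 + u^2) - L245*(t1*(p4*u + p2*v) - t2*(p2*p3 + p1*p4) + 2*u*v)
      - L246*(t1*p4*v - t2*p3*p4 + v^2),
    -- `F6`
    (-t2*p3*s1 + (t1*p3 - t2*p4)*s2 + (v + t1*p4)*s3) + L123*(t1*p2*p4 + p1*p3 + p4*u) +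
      L124*(p3^2 + t1*p4^2 + p4*v) - L125*(t2*p2*p4 + p3*u) - L126*(t2*p4^2 + p3*v) +
      L135*(t1*p2*u - t2*p1*p2 + u^2) + L136*(t1*(p4*u + p2*v) - t2*(p2*p3 + p1*p4) + 2*u*v)
      + L245*(t1*p4*v - t2*p3*p4 + v^2),
    -- `F7`
    (-s2^2 + s1*s3) + ((L123*p2 + L124*p4)*s1 - (L125*p2 + L126*p4)*s2) + L123*(L136*p2^2 +
      2*L245*p2*p4 + L246*p4^2) - L124*(L135*p2^2 + 2*L136*p2*p4 + L245*p4^2) -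
      L125*(L136*p1*p2 + L245*(p2*p3 + p1*p4) + L246*p3*p4) + L126*(L135*p1*p2 + L136*(p2*p3
      + p1*p4) + L245*p3*p4) + (L135*L245 - L136^2)*(-p1^2 + 2*u*p2 + t1*p2^2) + (L135*L246
      - L136*L245)*(-p1*p3 + u*p4 + v*p2 + t1*p2*p4) + (L136*L246 - L245^2)*(-p3^2 + 2*v*p4
      + t1*p4^2),
    -- `F8`
    (s2*s3 + t1*s1*s2 - t2*s1^2) + s1*(L123*p1 + L124*p3) - s2*(L125*p1 + L126*p3) +
      L123*(L136*p1*p2 + L245*(p1*p4 + p3*p2) + L246*p3*p4) - L124*(L135*p1*p2 + L136*(p1*p4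
      + p3*p2) + L245*p3*p4) - L125*(L136*p1^2 + 2*L245*p1*p3 + L246*p3^2) + L126*(L135*p1^2
      + 2*L136*p1*p3 + L245*p3^2) + (-L136^2 + L135*L245)*(2*u*p1 + 2*t1*p1*p2 - t2*p2^2) +
      (L135*L246 - L136*L245)*((v*p1 + u*p3) + t1*(p1*p4 + p3*p2) - t2*p2*p4) + (L246*L136 -
      L245^2)*(2*v*p3 + 2*t1*p3*p4 - t2*p4^2),
    -- `F9`
    (t1*s2^2 + s3^2 - s1*s2*t2) + s1*(L123*u + L124*v) - s2*(L125*u + L126*v) + (L124*L125 -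
      L123*L126)*(-p2*p3 + p1*p4) - L123*(L246*(p3^2 + t1*p4^2) + L136*(p1^2 + t1*p2^2) +
      2*L245*(p1*p3 + t1*p2*p4)) + L124*(L135*(p1^2 + t1*p2^2) + 2*L136*(p1*p3 + t1*p2*p4) +
      L245*(p3^2 + t1*p4^2)) + L125*t2*(L246*p4^2 + L136*p2^2 + 2*L245*p2*p4) -
      L126*t2*(L135*p2^2 + 2*L136*p2*p4 + L245*p4^2) + (-L136^2 + L135*L245)*(u^2 +
      2*t2*p1*p2) + (L135*L246 - L136*L245)*(u*v + t2*(p2*p3 + p1*p4)) + (L246*L136 -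
      L245^2)*(v^2 + 2*t2*p3*p4)]

/-- `G` as an element of `S_G`. -/
noncomputable def G : SG :=
  open MvPolynomial in
  polyG (X .p1) (X .p2) (X .p3) (X .p4) (X .u) (X .v) (X .t1) (X .t2)
    (X .L123) (X .L124) (X .L125) (X .L126) (X .L135) (X .L136) (X .L245) (X .L246)

/-- `F1, …, F9` as elements of `S_Π`. -/
noncomputable def F : Fin 9 → SPi :=
  open MvPolynomial in
  polyF (C (X .p1)) (C (X .p2)) (C (X .p3)) (C (X .p4)) (C (X .u)) (C (X .v))
    (C (X .t1)) (C (X .t2)) (C (X .L123)) (C (X .L124)) (C (X .L125)) (C (X .L126))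
    (C (X .L135)) (C (X .L136)) (C (X .L245)) (C (X .L246)) (X 0) (X 1) (X 2)

/-- The ideal `I_Π = (F1, …, F9)` of `S_Π`. -/
noncomputable def IPi : Ideal SPi := Ideal.span (Set.range F)

/-- `R_Π = S_Π / I_Π`. -/
abbrev RPi : Type := SPi ⧸ IPi

/-- `R_G = S_G / (G)`. -/
abbrev RG : Type := SG ⧸ Ideal.span {G}

/-- The quotient field `Q_G` of `R_G`. -/
abbrev QG : Type := FractionRing RG

/-- The ideal `J_D = I_D / (G)` of `R_G`. -/
noncomputable def JD : Ideal RG := ID.map (Ideal.Quotient.mk (Ideal.span {G}))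

/-- `J_D⁻¹ = {f ∈ Q_G | f J_D ⊆ R_G}`. -/
def JDinv : Set QG := {f | ∀ a ∈ JD, f * algebraMap RG QG a ∈ (algebraMap RG QG).range}

/-- The unprojection ring `R_G[J_D⁻¹]`, the subring of `Q_G` generated by `J_D⁻¹` over `R_G`. -/
noncomputable def unprojRing : Subalgebra RG QG := Algebra.adjoin RG JDinv

/-- The rescaling `L136 ↦ 3 L136`, `L245 ↦ 3 L245` of `S_G`, other coordinates unchanged. -/
noncomputable def rescale : SG →ₐ[ℂ] SG :=
  open MvPolynomial in
  aeval fun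
    | .L136 => 3 * X .L136
    | .L245 => 3 * X .L245
    | x => X x

end Unproj

/-!
Write `T = S_G[w] / (w³ + t1 w - t2)`, a free `S_G`-module with basis `1, w, w²`. Then
`S̃_G = T / (f₁, f₂)` with `f₁ = u - w p1 - w² p2` and `f₂ = v - w p3 - w² p4`, so that `S̃_G` is
the cokernel of the `3 × 6` matrix `M` over `S_G`. If `σ` denotes the `S_G`-linear functional on `T`
with values `s1, s2, s3` on `1, w, w²`, the polynomials `F1, …, F6` are
`σ (wⁱ fⱼ) + (an element of S_G)` for `i = 0, 1, 2`. This is what makes an `S_G`-linear relation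
between `1, w, w²` in `S̃_G` into a relation between `s1, s2, s3` modulo `S_G` in `R_Π`
(`exists_sub_C_mem_IPi`).

* `R_G` is a domain because `G` is linear in `L123` with prime coefficient `D123` (`prime_G`).
* Cramer's rule solves `F1 = F2 = F3 = 0` in `Q_G`, the remaining equations follow from `G = 0`
  (`exists_polyF_eq_zero`), and this gives a homomorphism `φ : S_Π → Q_G` that kills `I_Π`. It is
  built on the version `G'` of `G` in which `L136` and `L245` have been rescaled.
* The kernel of `φ` is `I_Π` (`ker_eq_IPi`). By `F7, F8, F9` every element of `S_Π` is, modulo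
  `I_Π`, a combination over `S_G` of `1` and the monomials `s1ⁱ sⱼ`. Each `sⱼ` has a simple pole along `D`,
  and the residues are in the ratio `1 : w : w²` (`exists_mul_X`). If a normal form of degree `n`
  with leading part `s1ⁿ⁻¹ (c₀ s1 + c₁ s2 + c₂ s3)` vanishes in `Q_G`, its polar part of order `n`
  vanishes, that is `c₀ + c₁ w + c₂ w² = 0` in `S̃_G`, and the leading part reduces to lower degree.
* The image of `φ` is `R_G[J_D⁻¹]`. That the `sⱼ` belong to `J_D⁻¹` is part of `exists_mul_X`.
  Conversely let `f ∈ J_D⁻¹` (`exists_map_eq_of_mul_mem`). Where `δ = p1 p4 - p2 p3` is invertible,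
  `D` is the complete intersection of `b1` and `b2`, and `G = b1 q2 - b2 q1` up to a power of `δ`
  with `s1 = q1 / b1 = q2 / b2`, whence `δ³ f ∈ R_G + R_G s1`. As `δ` is prime in `S̃_G` and does
  not divide the residue of `D123 s1`, the quotient of the residues of `f` and `s1` lies in
  `S̃_G = S_G + S_G w + S_G w²`, so that subtracting a combination of `s1, s2, s3` from `f` gives
  `f'` with `δ³ f' ∈ R_G`. Also `D135 f' ∈ R_G`, and `f' ∈ R_G` since `δ, D135, G` is a regular
  sequence.
-/

namespace Unproj

open MvPolynomial

-- The variables of `S_G`, `S̃_G` and `S_Π`, with the polynomial ring made explicit.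
local notation "Xg" => (X : VarG → SG)
local notation "Xn" => (X : VarN → SN)
local notation "Xs" => (X : Fin 3 → SPi)

/-! ### Polynomial identities -/

/-- The polynomial `G` after the rescaling `3 L136 ↦ L136`, `3 L245 ↦ L245`; this is the form of
`G` that is compatible with `F1, …, F9`. -/
def polyG' {A : Type*} [CommRing A] (p1 p2 p3 p4 u v t1 t2
    L123 L124 L125 L126 L135 L136 L245 L246 : A) : A :=
  let D : ℕ → ℕ → ℕ → A := minor (matM p1 p2 p3 p4 u v t1 t2)
  L123 * D 1 2 3 + L124 * D 1 2 4 + L125 * D 1 2 5 + L126 * D 1 2 6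
    + L135 * D 1 3 5 + L136 * (D 1 3 6 + 2 * D 1 4 5)
    + L245 * (D 2 4 5 + 2 * D 1 4 6) + L246 * D 2 4 6

section Identities

variable {A : Type*} [CommRing A] (p1 p2 p3 p4 u v t1 t2
    L123 L124 L125 L126 L135 L136 L245 L246 s1 s2 s3 : A)

local notation "GG" => polyG' p1 p2 p3 p4 u v t1 t2 L123 L124 L125 L126 L135 L136 L245 L246
local notation "FF" => polyF p1 p2 p3 p4 u v t1 t2 L123 L124 L125 L126 L135 L136 L245 L246 s1 s2 s3
local notation "DD" => minor (matM p1 p2 p3 p4 u v t1 t2)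

theorem polyG'_eq : GG =
    L123 * DD 1 2 3 + L124 * DD 1 2 4 + L125 * DD 1 2 5 + L126 * DD 1 2 6
    + L135 * DD 1 3 5 + L136 * (DD 1 3 6 + 2 * DD 1 4 5)
    + L245 * (DD 2 4 5 + 2 * DD 1 4 6) + L246 * DD 2 4 6 := rfl

theorem minor_eq {R : Type*} [CommRing R] (N : Matrix (Fin 3) (Fin 6) R) (i j k : ℕ)
    (a b c : Fin 6) (ha : Fin.ofNat 6 (i - 1) = a) (hb : Fin.ofNat 6 (j - 1) = b)
    (hc : Fin.ofNat 6 (k - 1) = c) :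
    minor N i j k = N 0 a * N 1 b * N 2 c - N 0 a * N 1 c * N 2 b - N 0 b * N 1 a * N 2 c
      + N 0 b * N 1 c * N 2 a + N 0 c * N 1 a * N 2 b - N 0 c * N 1 b * N 2 a := by
  subst ha hb hc
  exact Matrix.det_fin_three _

theorem minor_123 : DD 1 2 3 = -p2 * (p1 * p4 - p2 * p3) * t2 + ((p1 * p3 + p4 * u) * u - (p1 ^
    2 + p2 ^ 2 * t1 + p2 * u) * v + p2 * p4 * t1 * u) := by
  rw [minor_eq _ 1 2 3 0 1 2 rfl rfl rfl]
  simp only [matM, Matrix.of_apply, Matrix.cons_val]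
  ring

theorem minor_124 : DD 1 2 4 = -p1 * p3 * v - p1 * p4 ^ 2 * t2 + p2 * p3 * p4 * t2 - p2 * p4 * v
    * t1 - p2 * v ^ 2 + p3 ^ 2 * u + p4 ^ 2 * u * t1 + p4 * u * v := by
  rw [minor_eq _ 1 2 4 0 1 3 rfl rfl rfl]
  simp only [matM, Matrix.of_apply, Matrix.cons_val]
  ring

theorem minor_125 : DD 1 2 5 = -p1 ^ 2 * p4 * t2 + p1 * p2 * p3 * t2 + p1 * p4 * u * t1 + p1 * u
    * v + p2 ^ 2 * v * t2 - p2 * p3 * u * t1 - p2 * p4 * u * t2 - p3 * u ^ 2 := by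
  rw [minor_eq _ 1 2 5 0 1 4 rfl rfl rfl]
  simp only [matM, Matrix.of_apply, Matrix.cons_val]
  ring

theorem minor_126 : DD 1 2 6 = -p1 * p3 * p4 * t2 + p1 * p4 * v * t1 + p1 * v ^ 2 + p2 * p3 ^ 2
    * t2 - p2 * p3 * v * t1 + p2 * p4 * v * t2 - p3 * u * v - p4 ^ 2 * u * t2 := by
  rw [minor_eq _ 1 2 6 0 1 5 rfl rfl rfl]
  simp only [matM, Matrix.of_apply, Matrix.cons_val]
  ring

theorem minor_134 : DD 1 3 4 = -p1 ^ 2 * p4 * t2 + p1 * p2 * p3 * t2 + p1 * p4 * u * t1 + p1 * u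
    * v + p2 ^ 2 * v * t2 - p2 * p3 * u * t1 - p2 * p4 * u * t2 - p3 * u ^ 2 := by
  rw [minor_eq _ 1 3 4 0 2 3 rfl rfl rfl]
  simp only [matM, Matrix.of_apply, Matrix.cons_val]
  ring

theorem minor_135 : DD 1 3 5 = -p1 ^ 3 * t2 + p1 ^ 2 * u * t1 - p1 * p2 ^ 2 * t1 * t2 - 3 * p1 *
    p2 * u * t2 - p2 ^ 3 * t2 ^ 2 + p2 ^ 2 * u * t1 ^ 2 + 2 * p2 * u ^ 2 * t1 + u ^ 3 := by
  rw [minor_eq _ 1 3 5 0 2 4 rfl rfl rfl]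
  simp only [matM, Matrix.of_apply, Matrix.cons_val]
  ring

theorem minor_136 : DD 1 3 6 = -p1 ^ 2 * p3 * t2 + p1 ^ 2 * v * t1 - p1 * p2 * v * t2 - p1 * p4
    * u * t2 - p2 ^ 2 * p3 * t1 * t2 - p2 ^ 2 * p4 * t2 ^ 2 + p2 ^ 2 * v * t1 ^ 2 - p2 * p3 * u
    * t2 + 2 * p2 * u * v * t1 + u ^ 2 * v := by
  rw [minor_eq _ 1 3 6 0 2 5 rfl rfl rfl]
  simp only [matM, Matrix.of_apply, Matrix.cons_val]
  ring

theorem minor_145 : DD 1 4 5 = -p1 ^ 2 * p3 * t2 - p1 * p2 * p4 * t1 * t2 - p1 * p2 * v * t2 +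
    p1 * p3 * u * t1 - p1 * p4 * u * t2 - p2 ^ 2 * p4 * t2 ^ 2 - p2 * p3 * u * t2 + p2 * p4 * u
    * t1 ^ 2 + p2 * u * v * t1 + p4 * u ^ 2 * t1 + u ^ 2 * v := by
  rw [minor_eq _ 1 4 5 0 3 4 rfl rfl rfl]
  simp only [matM, Matrix.of_apply, Matrix.cons_val]
  ring

theorem minor_146 : DD 1 4 6 = -p1 * p3 ^ 2 * t2 + p1 * p3 * v * t1 - p1 * p4 * v * t2 - p2 * p3
    * p4 * t1 * t2 - p2 * p3 * v * t2 - p2 * p4 ^ 2 * t2 ^ 2 + p2 * p4 * v * t1 ^ 2 + p2 * v ^ 2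
    * t1 - p3 * p4 * u * t2 + p4 * u * v * t1 + u * v ^ 2 := by
  rw [minor_eq _ 1 4 6 0 3 5 rfl rfl rfl]
  simp only [matM, Matrix.of_apply, Matrix.cons_val]
  ring

theorem minor_234 : DD 2 3 4 = -p1 * p3 * p4 * t2 + p1 * p4 * v * t1 + p1 * v ^ 2 + p2 * p3 ^ 2
    * t2 - p2 * p3 * v * t1 + p2 * p4 * v * t2 - p3 * u * v - p4 ^ 2 * u * t2 := by
  rw [minor_eq _ 2 3 4 1 2 3 rfl rfl rfl]
  simp only [matM, Matrix.of_apply, Matrix.cons_val]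
  ring

theorem minor_245 : DD 2 4 5 = -p1 * p3 ^ 2 * t2 - p1 * p4 ^ 2 * t1 * t2 - p1 * p4 * v * t2 - p2
    * p3 * v * t2 - p2 * p4 ^ 2 * t2 ^ 2 + p3 ^ 2 * u * t1 - p3 * p4 * u * t2 + p4 ^ 2 * u * t1
    ^ 2 + 2 * p4 * u * v * t1 + u * v ^ 2 := by
  rw [minor_eq _ 2 4 5 1 3 4 rfl rfl rfl]
  simp only [matM, Matrix.of_apply, Matrix.cons_val]
  ring

theorem minor_246 : DD 2 4 6 = -p3 ^ 3 * t2 + p3 ^ 2 * v * t1 - p3 * p4 ^ 2 * t1 * t2 - 3 * p3 *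
    p4 * v * t2 - p4 ^ 3 * t2 ^ 2 + p4 ^ 2 * v * t1 ^ 2 + 2 * p4 * v ^ 2 * t1 + v ^ 3 := by
  rw [minor_eq _ 2 4 6 1 3 5 rfl rfl rfl]
  simp only [matM, Matrix.of_apply, Matrix.cons_val]
  ring

/-- The `4 × 4` determinant obtained from the first four columns of `M` by bordering them with the
linear forms `F1, …, F4` does not involve `s1, s2, s3`. -/
theorem minors_mul_F1_F2_F3_F4 :
    DD 2 3 4 * FF 0 - DD 1 3 4 * FF 1 + DD 1 2 4 * FF 2 - DD 1 2 3 * FF 3 =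
      -((p1 * p4 - p2 * p3) * GG) := by
  simp only [polyG', polyF, minor_123, minor_124, minor_125, minor_126, minor_134, minor_135,
    minor_136, minor_145, minor_146, minor_234, minor_245, minor_246, Matrix.cons_val]
  ring

/-- With `σ` the `A`-linear functional on `A[w] / (w³ + t1 w - t2)` sending `1, w, w²` to
`s1, s2, s3`, this computes `σ (w² (f₂ f₁ - f₁ f₂)) = 0` from `F1, …, F6`. -/
theorem polyG'_eq_combination :
    GG = -(v * FF 4 - p3 * (t2 * FF 0 - t1 * FF 2) - p4 * (t2 * FF 2 - t1 * FF 4)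
      - (u * FF 5 - p1 * (t2 * FF 1 - t1 * FF 3) - p2 * (t2 * FF 3 - t1 * FF 5))) := by
  simp only [polyG', polyF, minor_123, minor_124, minor_125, minor_126, minor_135,
    minor_136, minor_145, minor_146, minor_245, minor_246, Matrix.cons_val]
  ring

theorem det_mul_F5 : (p1 * p4 - p2 * p3) * FF 4 =
      (p1*v + p2*p4*t2) * FF 0 + (-p1*u - p2^2*t2) * FF 1 + (-p1*p3 - p2*p4*t1 - p2*v) * FF 2
      + (p1^2 + p2^2*t1 + p2*u) * FF 3 := by
  simp only [polyF, Matrix.cons_val]; ring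

theorem det_mul_F6 : (p1 * p4 - p2 * p3) * FF 5 =
      (p3*v + p4^2*t2) * FF 0 + (-p2*p4*t2 - p3*u) * FF 1 + (-p3^2 - p4^2*t1 - p4*v) * FF 2 +
      (p1*p3 + p2*p4*t1 + p4*u) * FF 3 := by
  simp only [polyF, Matrix.cons_val]; ring

theorem det_mul_F7 : (p1 * p4 - p2 * p3) * FF 6 =
      (-p1*p2*L135 - p1*p4*L136 - p2*p3*L136 - p3*p4*L245 + p4*s2) * FF 0 + (-p1*p2*L136 -
      p1*p4*L245 - p2*p3*L245 - p2*s2 - p3*p4*L246) * FF 1 + (p2^2*L135 + 2*p2*p4*L136 +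
      p4^2*L245 - p4*s1) * FF 2 + (p2^2*L136 + 2*p2*p4*L245 + p2*s1 + p4^2*L246) * FF 3 := by
  simp only [polyF, Matrix.cons_val]; ring

theorem det_mul_F8 : (p1 * p4 - p2 * p3) * FF 7 =
      (-p1^2*L135 - 2*p1*p3*L136 - p3^2*L245 + p3*s2) * FF 0 + (-p1^2*L136 - 2*p1*p3*L245 -
      p1*s2 - p3^2*L246) * FF 1 + (p1*p2*L135 + p1*p4*L136 + p2*p3*L136 + p3*p4*L245 - p3*s1) *
      FF 2 + (p1*p2*L136 + p1*p4*L245 + p1*s1 + p2*p3*L245 + p3*p4*L246) * FF 3 := by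
  simp only [polyF, Matrix.cons_val]; ring

theorem det_mul_F9 : (p1 * p4 - p2 * p3) * FF 8 =
      (p1*p4*L123 + p2^2*t2*L135 - p2*p3*L123 + 2*p2*p4*t2*L136 + p4^2*t2*L245 + v*s2) * FF 0
      + (p1*p4*L124 + p2^2*t2*L136 - p2*p3*L124 + 2*p2*p4*t2*L245 + p4^2*t2*L246 - u*s2) * FF 1
      + (p2*u*L135 + p2*v*L136 - p3*s2 + p4*u*L136 + p4*v*L245 - p4*s3) * FF 2 + (p1*s2 +
      p2*u*L136 + p2*v*L245 + p2*s3 + p4*u*L245 + p4*v*L246) * FF 3 := by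
  simp only [polyF, Matrix.cons_val]; ring

local notation "FC" => polyF p1 p2 p3 p4 u v t1 t2 L123 L124 L125 L126 L135 L136 L245 L246 0 0 0

/-- An element of `I_D` that together with `relTwo` generates `I_D` away from
`p1 p4 - p2 p3 = 0`, where `w = (p4 u - p2 v) / (p1 p4 - p2 p3)` and
`w² = (p1 v - p3 u) / (p1 p4 - p2 p3)` on `D`. -/
def relOne : A := (p4 * u - p2 * v) ^ 2 - (p1 * p4 - p2 * p3) * (p1 * v - p3 * u)

/-- The relation `t2 = w³ + t1 w` of `D`, cleared of denominators, where
`w = (p4 u - p2 v) / (p1 p4 - p2 p3)` and `w² = (p1 v - p3 u) / (p1 p4 - p2 p3)`. -/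
def relTwo : A := (p1 * p4 - p2 * p3) ^ 2 * t2
  - (p4 * u - p2 * v) * ((p1 * v - p3 * u) + t1 * (p1 * p4 - p2 * p3))

/-- The product of `s1` and `relOne`, as a polynomial in the coordinates of `S_G`. -/
def mulRelOne : A := -((p4 * u - p2 * v) * (p4 * FC 0 - p2 * FC 1)
  + (p1 * p4 - p2 * p3) * ((p4 * FC 2 - p2 * FC 3) - (p1 * FC 1 - p3 * FC 0)))

/-- The product of `s1` and `relTwo`, as a polynomial in the coordinates of `S_G`. -/
def mulRelTwo : A := t1 * (p1 * p4 - p2 * p3) * (p4 * FC 0 - p2 * FC 1)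
  + (p4 * u - p2 * v) * (p1 * FC 1 - p3 * FC 0)
  + (p1 * p4 - p2 * p3) * (p4 * FC 4 - p2 * FC 5)

local notation "B1" => relOne p1 p2 p3 p4 u v
local notation "B2" => relTwo p1 p2 p3 p4 u v t1 t2
local notation "Q1" => mulRelOne p1 p2 p3 p4 u v t1 t2 L123 L124 L125 L126 L135 L136 L245 L246
local notation "Q2" => mulRelTwo p1 p2 p3 p4 u v t1 t2 L123 L124 L125 L126 L135 L136 L245 L246

theorem mul_relTwo_of_polyF_eq_zero (hF : ∀ i, FF i = 0) : s1 * B2 = Q2 := by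
  have h0 := hF 0
  have h1 := hF 1
  have h4 := hF 4
  have h5 := hF 5
  simp only [polyF, Matrix.cons_val] at h0 h1 h4 h5
  simp only [relTwo, mulRelTwo, polyF, Matrix.cons_val]
  linear_combination -t1 * (p1 * p4 - p2 * p3) * (p4 * h0 - p2 * h1)
    - (p4 * u - p2 * v) * (p1 * h1 - p3 * h0)
    - (p1 * p4 - p2 * p3) * (p4 * h4 - p2 * h5)

/-- Away from `p1 p4 - p2 p3 = 0` the hypersurface `G` lies in the complete intersection
`relOne = relTwo = 0`, and the coefficients are the numerators of `s1`. -/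
theorem det_cube_mul_polyG' : (p1 * p4 - p2 * p3) ^ 3 * GG = B1 * Q2 - B2 * Q1 := by
  simp only [polyG', polyF, relOne, relTwo, mulRelOne, mulRelTwo, minor_123, minor_124,
    minor_125, minor_126, minor_135, minor_136, minor_145, minor_146,
    minor_245, minor_246, Matrix.cons_val]
  ring

end Identities

theorem exists_solution_three {K : Type*} [Field K] (a₁ a₂ a₃ b₁ b₂ b₃ c₁ c₂ c₃ d₁ d₂ d₃ : K)
    (h : a₁ * (b₂ * c₃ - b₃ * c₂) - a₂ * (b₁ * c₃ - b₃ * c₁) + a₃ * (b₁ * c₂ - b₂ * c₁) ≠ 0) :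
    ∃ s : Fin 3 → K, a₁ * s 0 + a₂ * s 1 + a₃ * s 2 = d₁ ∧ b₁ * s 0 + b₂ * s 1 + b₃ * s 2 = d₂ ∧
      c₁ * s 0 + c₂ * s 1 + c₃ * s 2 = d₃ := by
  set e := a₁ * (b₂ * c₃ - b₃ * c₂) - a₂ * (b₁ * c₃ - b₃ * c₁) + a₃ * (b₁ * c₂ - b₂ * c₁) with he
  refine ⟨![(d₁ * (b₂ * c₃ - b₃ * c₂) - a₂ * (d₂ * c₃ - b₃ * d₃) + a₃ * (d₂ * c₂ - b₂ * d₃)) / e,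
    (a₁ * (d₂ * c₃ - b₃ * d₃) - d₁ * (b₁ * c₃ - b₃ * c₁) + a₃ * (b₁ * d₃ - d₂ * c₁)) / e,
    (a₁ * (b₂ * d₃ - d₂ * c₂) - a₂ * (b₁ * d₃ - d₂ * c₁) + d₁ * (b₁ * c₂ - b₂ * c₁)) / e], ?_⟩
  simp only [Matrix.cons_val]
  refine ⟨?_, ?_, ?_⟩ <;> field_simp <;> rw [he] <;> ring

/-- Where `p1 p4 - p2 p3` and a minor are invertible, the nine equations `F1, …, F9` can be solved
for `s1, s2, s3` on the hypersurface `G`: Cramer's rule solves the first three, the fourth follows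
from `G`, and the others are consequences of these four. -/
theorem exists_polyF_eq_zero {K : Type*} [Field K] (p1 p2 p3 p4 u v t1 t2
    L123 L124 L125 L126 L135 L136 L245 L246 : K)
    (hG : polyG' p1 p2 p3 p4 u v t1 t2 L123 L124 L125 L126 L135 L136 L245 L246 = 0)
    (hdet : p1 * p4 - p2 * p3 ≠ 0) (hD : minor (matM p1 p2 p3 p4 u v t1 t2) 1 2 3 ≠ 0) :
    ∃ s : Fin 3 → K, ∀ i, polyF p1 p2 p3 p4 u v t1 t2 L123 L124 L125 L126 L135 L136 L245 L246
      (s 0) (s 1) (s 2) i = 0 := by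
  obtain ⟨s, h0, h1, h2⟩ := exists_solution_three u (-p1) (-p2) v (-p3) (-p4)
    (-t2 * p2) (u + t1 * p2) (-p1)
    (-polyF p1 p2 p3 p4 u v t1 t2 L123 L124 L125 L126 L135 L136 L245 L246 0 0 0 0)
    (-polyF p1 p2 p3 p4 u v t1 t2 L123 L124 L125 L126 L135 L136 L245 L246 0 0 0 1)
    (-polyF p1 p2 p3 p4 u v t1 t2 L123 L124 L125 L126 L135 L136 L245 L246 0 0 0 2) (by
      rw [minor_123] at hD
      convert hD using 1
      ring)
  refine ⟨s, ?_⟩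
  replace h0 : polyF p1 p2 p3 p4 u v t1 t2 L123 L124 L125 L126 L135 L136 L245 L246
      (s 0) (s 1) (s 2) 0 = 0 := by
    simp only [polyF, Matrix.cons_val] at h0 ⊢
    linear_combination h0
  replace h1 : polyF p1 p2 p3 p4 u v t1 t2 L123 L124 L125 L126 L135 L136 L245 L246
      (s 0) (s 1) (s 2) 1 = 0 := by
    simp only [polyF, Matrix.cons_val] at h1 ⊢
    linear_combination h1
  replace h2 : polyF p1 p2 p3 p4 u v t1 t2 L123 L124 L125 L126 L135 L136 L245 L246
      (s 0) (s 1) (s 2) 2 = 0 := by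
    simp only [polyF, Matrix.cons_val] at h2 ⊢
    linear_combination h2
  have h3 : polyF p1 p2 p3 p4 u v t1 t2 L123 L124 L125 L126 L135 L136 L245 L246
      (s 0) (s 1) (s 2) 3 = 0 := by
    have := minors_mul_F1_F2_F3_F4 p1 p2 p3 p4 u v t1 t2
      L123 L124 L125 L126 L135 L136 L245 L246 (s 0) (s 1) (s 2)
    rw [h0, h1, h2, hG] at this
    simpa [hD] using this
  have key : ∀ {x : K}, (p1 * p4 - p2 * p3) * x = 0 → x = 0 := fun h =>
    (mul_eq_zero.1 h).resolve_left hdet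
  intro i
  fin_cases i
  · exact h0
  · exact h1
  · exact h2
  · exact h3
  all_goals apply key
  · erw [det_mul_F5, h0, h1, h2, h3]; ring
  · erw [det_mul_F6, h0, h1, h2, h3]; ring
  · erw [det_mul_F7, h0, h1, h2, h3]; ring
  · erw [det_mul_F8, h0, h1, h2, h3]; ring
  · erw [det_mul_F9, h0, h1, h2, h3]; ring

/-! ### Ring homomorphisms and prime elements -/

theorem not_dvd_of_eval {σ : Type*} (x : σ → ℂ) {p q : MvPolynomial σ ℂ} (hp : eval x p = 0)
    (hq : eval x q ≠ 0) : ¬ p ∣ q := by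
  rintro ⟨r, rfl⟩
  simp [hp] at hq

theorem notMem_vars_of_mem_supported {σ : Type*} {i : σ} {p : MvPolynomial σ ℂ}
    (hp : p ∈ supported ℂ ({i}ᶜ : Set σ)) : i ∉ p.vars := fun hi =>
  mem_supported.1 hp hi rfl

theorem prime_mul_X_add {σ : Type*} (f g : MvPolynomial σ ℂ) (i : σ) (hf0 : f ≠ 0)
    (hf : f ∈ supported ℂ ({i}ᶜ : Set σ)) (hg : g ∈ supported ℂ ({i}ᶜ : Set σ))
    (h : IsRelPrime f g) : Prime (f * X i + g) :=
  (irreducible_mul_X_add f g i hf0 (notMem_vars_of_mem_supported hf)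
    (notMem_vars_of_mem_supported hg) h).prime

theorem prime_X_mul_X_sub {σ : Type*} {a b c d : σ} (hab : a ≠ b) (hac : a ≠ c) (had : a ≠ d)
    (hbd : b ≠ d) (hcd : c ≠ d) : Prime (X a * X d - X b * X c : MvPolynomial σ ℂ) := by
  classical
  rw [sub_eq_add_neg]
  refine prime_mul_X_add _ _ _ (X_ne_zero _) (X_mem_supported.2 (by simpa using had))
    (neg_mem (mul_mem (X_mem_supported.2 (by simpa using hbd))
      (X_mem_supported.2 (by simpa using hcd)))) ?_
  refine (X_prime (R := ℂ) (i := a)).irreducible.isRelPrime_iff_not_dvd.2 ?_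
  exact not_dvd_of_eval (fun i => if i = a then 0 else 1) (by simp) (by simp [hab.symm, hac.symm])

section Map

variable {A B : Type*} [CommRing A] [CommRing B] (f : A →+* B) (p1 p2 p3 p4 u v t1 t2
    L123 L124 L125 L126 L135 L136 L245 L246 s1 s2 s3 : A)

theorem map_minor_matM (i j k : ℕ) : f (minor (matM p1 p2 p3 p4 u v t1 t2) i j k) =
    minor (matM (f p1) (f p2) (f p3) (f p4) (f u) (f v) (f t1) (f t2)) i j k := by
  have h : matM (f p1) (f p2) (f p3) (f p4) (f u) (f v) (f t1) (f t2) =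
      (matM p1 p2 p3 p4 u v t1 t2).map f := by
    ext i j
    fin_cases i <;> fin_cases j <;> simp [matM]
  rw [h, minor, minor, RingHom.map_det]
  rfl

theorem map_polyG' : f (polyG' p1 p2 p3 p4 u v t1 t2
      L123 L124 L125 L126 L135 L136 L245 L246) =
    polyG' (f p1) (f p2) (f p3) (f p4) (f u) (f v) (f t1) (f t2) (f L123) (f L124) (f L125) (f L126)
      (f L135) (f L136) (f L245) (f L246) := by
  simp only [polyG'_eq, map_add, map_mul, map_ofNat, map_minor_matM]

theorem map_polyF (i : Fin 9) : f (polyF p1 p2 p3 p4 u v t1 t2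
      L123 L124 L125 L126 L135 L136 L245 L246 s1 s2 s3 i) =
    polyF (f p1) (f p2) (f p3) (f p4) (f u) (f v) (f t1) (f t2) (f L123) (f L124) (f L125) (f L126)
      (f L135) (f L136) (f L245) (f L246) (f s1) (f s2) (f s3) i := by
  fin_cases i <;>
  simp only [Fin.zero_eta, Fin.mk_one, Fin.reduceFinMk, polyF, Matrix.cons_val, map_add, map_sub,
    map_mul, map_neg, map_pow, map_ofNat]

end Map

@[simp] theorem h_X_p1 : h (Xg .p1) = Xn .p1 := by simp [h]

@[simp] theorem h_X_p2 : h (Xg .p2) = Xn .p2 := by simp [h]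

@[simp] theorem h_X_p3 : h (Xg .p3) = Xn .p3 := by simp [h]

@[simp] theorem h_X_p4 : h (Xg .p4) = Xn .p4 := by simp [h]

@[simp] theorem h_X_u : h (Xg .u) = Xn .w * Xn .p1 + Xn .w ^ 2 * Xn .p2 := by simp [h]

@[simp] theorem h_X_v : h (Xg .v) = Xn .w * Xn .p3 + Xn .w ^ 2 * Xn .p4 := by simp [h]

@[simp] theorem h_X_t1 : h (Xg .t1) = Xn .t1 := by simp [h]

@[simp] theorem h_X_t2 : h (Xg .t2) = Xn .w ^ 3 + Xn .t1 * Xn .w := by simp [h]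

@[simp] theorem h_X_L123 : h (Xg .L123) = Xn .L123 := by simp [h]

@[simp] theorem h_X_L124 : h (Xg .L124) = Xn .L124 := by simp [h]

@[simp] theorem h_X_L125 : h (Xg .L125) = Xn .L125 := by simp [h]

@[simp] theorem h_X_L126 : h (Xg .L126) = Xn .L126 := by simp [h]

@[simp] theorem h_X_L135 : h (Xg .L135) = Xn .L135 := by simp [h]

@[simp] theorem h_X_L136 : h (Xg .L136) = Xn .L136 := by simp [h]

@[simp] theorem h_X_L245 : h (Xg .L245) = Xn .L245 := by simp [h]

@[simp] theorem h_X_L246 : h (Xg .L246) = Xn .L246 := by simp [h]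

/-- The element `p1 p4 - p2 p3` of `S_G`. -/
noncomputable def det : SG := Xg .p1 * Xg .p4 - Xg .p2 * Xg .p3

/-- The element `p1 p4 - p2 p3` of `S̃_G`. -/
noncomputable def detN : SN := Xn .p1 * Xn .p4 - Xn .p2 * Xn .p3

theorem h_det : h det = detN := by simp [det, detN]

theorem prime_det : Prime det := prime_X_mul_X_sub (by simp) (by simp) (by simp) (by simp) (by simp)

theorem prime_detN : Prime detN :=
  prime_X_mul_X_sub (by simp) (by simp) (by simp) (by simp) (by simp)

/-- The matrix `M` over `S_G`. -/
noncomputable abbrev matSG : Matrix (Fin 3) (Fin 6) SG :=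
  matM (Xg .p1) (Xg .p2) (Xg .p3) (Xg .p4) (Xg .u) (Xg .v) (Xg .t1) (Xg .t2)

theorem prime_minor_123 : Prime (minor matSG 1 2 3) := by
  rw [matSG, minor_123]
  refine prime_mul_X_add _ _ _ ?_ ?_ ?_ ?_
  · exact mul_ne_zero (neg_ne_zero.2 (X_ne_zero _)) prime_det.ne_zero
  · apply_rules [pow_mem, add_mem, mul_mem, sub_mem, neg_mem, X_mem_supported.2] <;> simp
  · apply_rules [pow_mem, add_mem, mul_mem, sub_mem, neg_mem, X_mem_supported.2] <;> simp
  · refine IsRelPrime.mul_left ?_ ?_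
    · rw [IsRelPrime.neg_left_iff, (X_prime (R := ℂ)).irreducible.isRelPrime_iff_not_dvd]
      exact not_dvd_of_eval (fun | .p1 => 1 | .v => 1 | _ => 0) (by simp) (by simp)
    · refine prime_det.irreducible.isRelPrime_iff_not_dvd.2 ?_
      exact not_dvd_of_eval (fun | .p1 => 1 | .v => 1 | _ => 0) (by simp [det]) (by simp)

theorem minor_mem {R : Type*} [CommRing R] {S : Type*} [SetLike S R] [SubringClass S R] {s : S}
    {N : Matrix (Fin 3) (Fin 6) R} (hN : ∀ i j, N i j ∈ s) (i j k : ℕ) : minor N i j k ∈ s := by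
  rw [minor_eq _ i j k _ _ _ rfl rfl rfl]
  apply_rules [add_mem, mul_mem, sub_mem]

/-- `G` is linear in `L123` with prime coefficient, which does not divide the other terms. -/
theorem prime_G : Prime G := by
  have hG : G = minor matSG 1 2 3 * Xg .L123 + (Xg .L124 * minor matSG 1 2 4
      + Xg .L125 * minor matSG 1 2 5 + Xg .L126 * minor matSG 1 2 6 + Xg .L135 * minor matSG 1 3 5
      + 3 * Xg .L136 * (minor matSG 1 3 6 + 2 * minor matSG 1 4 5)
      + 3 * Xg .L245 * (minor matSG 2 4 5 + 2 * minor matSG 1 4 6)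
      + Xg .L246 * minor matSG 2 4 6) := by
    simp only [G, polyG]; ring
  rw [hG]
  have hX : ∀ i, i ≠ .L123 → X i ∈ supported ℂ ({.L123}ᶜ : Set VarG) := fun i hi =>
    X_mem_supported.2 hi
  have hM : ∀ i j k, minor matSG i j k ∈ supported ℂ ({.L123}ᶜ : Set VarG) := by
    have : ∀ i j, matSG i j ∈ supported ℂ ({.L123}ᶜ : Set VarG) := by
      simp only [Fin.forall_fin_succ, matSG, matM, Matrix.of_apply, Fin.succ_zero_eq_one,
        Fin.succ_one_eq_two, Matrix.cons_val, IsEmpty.forall_iff, and_true]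
      refine ⟨⟨?_, ?_, ?_, ?_, ?_, ?_⟩, ⟨?_, ?_, ?_, ?_, ?_, ?_⟩, ?_, ?_, ?_, ?_, ?_, ?_⟩ <;>
      apply_rules [add_mem, mul_mem, sub_mem, neg_mem, X_mem_supported.2] <;> simp
    exact fun i j k => minor_mem (N := matSG) this i j k
  refine prime_mul_X_add _ _ _ prime_minor_123.ne_zero (hM _ _ _) ?_ ?_
  · have h2 : (2 : SG) ∈ supported ℂ ({.L123}ᶜ : Set VarG) := ofNat_mem _ 2
    have h3 : (3 : SG) ∈ supported ℂ ({.L123}ᶜ : Set VarG) := ofNat_mem _ 3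
    generalize minor matSG = D at hM
    apply_rules [add_mem, mul_mem, hX, hM] <;> simp
  · refine prime_minor_123.irreducible.isRelPrime_iff_not_dvd.2 ?_
    exact not_dvd_of_eval (fun | .u => 1 | .L135 => 1 | _ => 0) (by simp [matSG, minor_123])
      (by simp [matSG, minor_124, minor_125, minor_126, minor_135, minor_136,
        minor_145, minor_146, minor_245, minor_246])

/-- `relOne` as an element of `S_G`. -/
noncomputable def b1 : SG := relOne (Xg .p1) (Xg .p2) (Xg .p3) (Xg .p4) (Xg .u) (Xg .v)

/-- `relTwo` as an element of `S_G`. -/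
noncomputable def b2 : SG :=
  relTwo (Xg .p1) (Xg .p2) (Xg .p3) (Xg .p4) (Xg .u) (Xg .v) (Xg .t1) (Xg .t2)

theorem prime_b2 : Prime b2 := by
  rw [b2, relTwo, sub_eq_add_neg]
  refine prime_mul_X_add _ _ _ (pow_ne_zero _ prime_det.ne_zero) ?_ ?_ ?_
  · apply_rules [pow_mem, add_mem, mul_mem, sub_mem, neg_mem, X_mem_supported.2] <;> simp
  · apply_rules [pow_mem, add_mem, mul_mem, sub_mem, neg_mem, X_mem_supported.2] <;> simp
  · refine IsRelPrime.pow_left (prime_det.irreducible.isRelPrime_iff_not_dvd.2 ?_)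
    exact not_dvd_of_eval (fun | .p1 => 1 | .p2 => 1 | .p3 => 1 | .p4 => 1 | .u => 1 | _ => 0)
      (by simp [det]) (by simp)

theorem not_b2_dvd_b1 : ¬ b2 ∣ b1 :=
  not_dvd_of_eval (fun | .p4 => 1 | .u => 1 | _ => 0) (by simp [b2, relTwo]) (by simp [b1, relOne])

theorem b1_mem_ID : b1 ∈ ID := by
  rw [ID, RingHom.mem_ker]
  simp only [b1, relOne, map_sub, map_mul, map_pow, h_X_p1, h_X_p2, h_X_p3, h_X_p4,
    h_X_u, h_X_v]
  ring

theorem b2_mem_ID : b2 ∈ ID := by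
  rw [ID, RingHom.mem_ker]
  simp only [b2, relTwo, map_add, map_sub, map_mul, map_pow, h_X_p1, h_X_p2, h_X_p3, h_X_p4,
    h_X_u, h_X_v, h_X_t1, h_X_t2]
  ring

/-- `G` after the rescaling `3 L136 ↦ L136`, `3 L245 ↦ L245`, as an element of `S_G`. -/
noncomputable def G' : SG :=
  polyG' (Xg .p1) (Xg .p2) (Xg .p3) (Xg .p4) (Xg .u) (Xg .v) (Xg .t1) (Xg .t2)
    (Xg .L123) (Xg .L124) (Xg .L125) (Xg .L126) (Xg .L135) (Xg .L136) (Xg .L245) (Xg .L246)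

theorem not_G'_dvd_det : ¬ G' ∣ det :=
  not_dvd_of_eval (fun | .p1 => 1 | .p4 => 1 | _ => 0) (by simp [G', polyG'_eq]) (by simp [det])

theorem not_G'_dvd_b2 : ¬ G' ∣ b2 :=
  not_dvd_of_eval (fun | .p1 => 1 | .p4 => 1 | .t2 => 1 | _ => 0) (by simp [G', polyG'_eq])
    (by simp [b2, relTwo])

theorem not_G'_dvd_minor_123 : ¬ G' ∣ minor matSG 1 2 3 :=
  not_dvd_of_eval (fun | .p4 => 1 | .u => 1 | _ => 0) (by simp [G', polyG'_eq])
    (by simp [matSG, minor_123])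

theorem G'_mem_ID : G' ∈ ID := by
  rw [ID, RingHom.mem_ker, G', ← AlgHom.coe_toRingHom, map_polyG']
  simp only [AlgHom.coe_toRingHom, h_X_p1, h_X_p2, h_X_p3, h_X_p4, h_X_u, h_X_v, h_X_t1, h_X_t2,
    polyG'_eq, minor_123, minor_124, minor_125, minor_126, minor_135, minor_136, minor_145,
    minor_146, minor_245, minor_246]
  ring

theorem minor_135_mem_ID : minor matSG 1 3 5 ∈ ID := by
  rw [ID, RingHom.mem_ker, ← AlgHom.coe_toRingHom, map_minor_matM]
  simp only [AlgHom.coe_toRingHom, h_X_p1, h_X_p2, h_X_p3, h_X_p4, h_X_u, h_X_v, h_X_t1, h_X_t2,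
    minor_135]
  ring

theorem minor_123_mem_ID : minor matSG 1 2 3 ∈ ID := by
  rw [ID, RingHom.mem_ker, ← AlgHom.coe_toRingHom, map_minor_matM]
  simp only [AlgHom.coe_toRingHom, h_X_p1, h_X_p2, h_X_p3, h_X_p4, h_X_u, h_X_v, h_X_t1, h_X_t2,
    minor_123]
  ring

theorem not_det_dvd_minor_135 : ¬ det ∣ minor matSG 1 3 5 :=
  not_dvd_of_eval (fun | .u => 1 | _ => 0) (by simp [det]) (by simp [matSG, minor_135])

/-! ### The normalization as a module over `S_G` -/

/-- The lift `S̃_G → S_G[w]` that fixes the coordinates common to `S_G` and `S̃_G`. -/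
noncomputable def liftSN : SN →ₐ[ℂ] Polynomial SG :=
  aeval fun
    | .p1 => .C (Xg .p1)
    | .p2 => .C (Xg .p2)
    | .p3 => .C (Xg .p3)
    | .p4 => .C (Xg .p4)
    | .t1 => .C (Xg .t1)
    | .w => .X
    | .L123 => .C (Xg .L123)
    | .L124 => .C (Xg .L124)
    | .L125 => .C (Xg .L125)
    | .L126 => .C (Xg .L126)
    | .L135 => .C (Xg .L135)
    | .L136 => .C (Xg .L136)
    | .L245 => .C (Xg .L245)
    | .L246 => .C (Xg .L246)

/-- The kernel of `S_G[w] → S̃_G`, given by generators. -/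
noncomputable def relIdeal : Ideal (Polynomial SG) :=
  Ideal.span {Polynomial.C (Xg .u) - Polynomial.X * Polynomial.C (Xg .p1)
      - Polynomial.X ^ 2 * Polynomial.C (Xg .p2),
    Polynomial.C (Xg .v) - Polynomial.X * Polynomial.C (Xg .p3)
      - Polynomial.X ^ 2 * Polynomial.C (Xg .p4),
    Polynomial.X ^ 3 + Polynomial.X * Polynomial.C (Xg .t1) - Polynomial.C (Xg .t2)}

theorem C_sub_liftSN_mem (a : SG) : Polynomial.C a - liftSN (h a) ∈ relIdeal := by
  rw [← Ideal.Quotient.eq]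
  have : (Ideal.Quotient.mkₐ ℂ relIdeal).comp (Algebra.ofId SG (Polynomial SG)|>.restrictScalars ℂ)
      = (Ideal.Quotient.mkₐ ℂ relIdeal).comp (liftSN.comp h) := by
    refine MvPolynomial.algHom_ext fun i => ?_
    have hC : ∀ a : SG, Algebra.ofId SG (Polynomial SG) a = Polynomial.C a := fun a => rfl
    simp only [AlgHom.comp_apply, AlgHom.restrictScalars_apply, Ideal.Quotient.mkₐ_eq_mk, hC]
    rw [Ideal.Quotient.eq]
    cases i
    case u =>
      refine Ideal.subset_span (Or.inl ?_)
      simp [liftSN]; ring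
    case v =>
      refine Ideal.subset_span (Or.inr (Or.inl ?_))
      simp [liftSN]; ring
    case t2 =>
      rw [← neg_mem_iff]
      refine Ideal.subset_span (Or.inr (Or.inr ?_))
      simp [liftSN]
    all_goals simp [liftSN]
  exact DFunLike.congr_fun this a

theorem mem_relIdeal_of_h_eq_zero {a b c : SG} (habc : h a + Xn .w * h b + Xn .w ^ 2 * h c = 0) :
    Polynomial.C a + Polynomial.X * Polynomial.C b + Polynomial.X ^ 2 * Polynomial.C c
      ∈ relIdeal := by
  have hw : liftSN (Xn .w) = Polynomial.X := by simp [liftSN]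
  have h0 := congrArg liftSN habc
  simp only [map_add, map_mul, map_pow, hw, map_zero] at h0
  have := add_mem (add_mem (C_sub_liftSN_mem a)
    (relIdeal.mul_mem_left Polynomial.X (C_sub_liftSN_mem b)))
    (relIdeal.mul_mem_left (Polynomial.X ^ 2) (C_sub_liftSN_mem c))
  convert this using 1
  linear_combination h0

/-- The sequence `s1, s2, s3, …` satisfying the recursion of the powers of a root of
`w³ + t1 w - t2`. -/
noncomputable def sSeq : ℕ → SPi
  | 0 => Xs 0
  | 1 => Xs 1
  | 2 => Xs 2
  | n + 3 => C (Xg .t2) * sSeq n - C (Xg .t1) * sSeq (n + 1)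

/-- The `S_G`-linear functional on `S_G[w]` that sends `wⁿ` to `sSeq n`. -/
noncomputable def sFun : Polynomial SG →ₗ[SG] SPi :=
  Polynomial.lsum fun n => LinearMap.toSpanSingleton SG SPi (sSeq n)

theorem sFun_monomial (n : ℕ) (a : SG) : sFun (Polynomial.monomial n a) = C a * sSeq n := by
  rw [sFun, Polynomial.lsum_apply, Polynomial.sum_monomial_index _ _ (by simp)]
  simp [MvPolynomial.smul_eq_C_mul]

/-- The ideal `I_Π` as an `S_G`-submodule. -/
noncomputable abbrev subPi : Submodule SG SPi := IPi.restrictScalars SG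

theorem mem_subPi {f : SPi} : f ∈ subPi ↔ f ∈ IPi := Iff.rfl

theorem F_mem (i : Fin 9) : F i ∈ IPi := Ideal.subset_span ⟨i, rfl⟩

/-- The polynomials `F1, …, F9` at `s1 = s2 = s3 = 0`. -/
noncomputable def F0 : Fin 9 → SG :=
  polyF (Xg .p1) (Xg .p2) (Xg .p3) (Xg .p4) (Xg .u) (Xg .v)
    (Xg .t1) (Xg .t2) (Xg .L123) (Xg .L124) (Xg .L125) (Xg .L126)
    (Xg .L135) (Xg .L136) (Xg .L245) (Xg .L246) 0 0 0

theorem C_F0 (i : Fin 9) : (C (F0 i) : SPi) =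
    polyF (A := SPi) (C (Xg .p1)) (C (Xg .p2)) (C (Xg .p3)) (C (Xg .p4)) (C (Xg .u)) (C (Xg .v))
    (C (Xg .t1)) (C (Xg .t2)) (C (Xg .L123)) (C (Xg .L124)) (C (Xg .L125)) (C (Xg .L126))
    (C (Xg .L135)) (C (Xg .L136)) (C (Xg .L245)) (C (Xg .L246)) 0 0 0 i := by
  rw [F0, map_polyF]
  simp only [map_zero]

theorem C_mem_sup (a : SG) (S : Submodule SG SPi) : (C a : SPi) ∈ S ⊔ Submodule.span SG {1} := by
  refine Submodule.mem_sup_right (Submodule.mem_span_singleton.2 ⟨a, ?_⟩)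
  rw [MvPolynomial.smul_eq_C_mul, mul_one]

theorem mem_sup_of_eq {f : SPi} (i : Fin 9) (hf : f = F i - C (F0 i)) :
    f ∈ subPi ⊔ Submodule.span SG {1} :=
  hf ▸ sub_mem (Submodule.mem_sup_left (F_mem i)) (C_mem_sup _ _)

theorem C_mul_mem {S : Submodule SG SPi} (a : SG) {f : SPi} (hf : f ∈ S) : C a * f ∈ S := by
  rw [← MvPolynomial.smul_eq_C_mul]
  exact S.smul_mem a hf

theorem sSeq_mem_one (n : ℕ) : C (Xg .u) * sSeq n - C (Xg .p1) * sSeq (n + 1)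
    - C (Xg .p2) * sSeq (n + 2) ∈ subPi ⊔ Submodule.span SG {1} := by
  induction n using Nat.strong_induction_on with
  | _ n ih =>
    match n with
    | 0 =>
      refine mem_sup_of_eq 0 ?_
      simp only [C_F0, F, polyF, Matrix.cons_val, sSeq]; ring
    | 1 =>
      refine mem_sup_of_eq 2 ?_
      simp only [C_F0, F, polyF, Matrix.cons_val, sSeq]; ring
    | 2 =>
      refine mem_sup_of_eq 4 ?_
      simp only [C_F0, F, polyF, Matrix.cons_val, sSeq]; ring
    | n + 3 =>
      have := sub_mem (C_mul_mem (Xg .t2) (ih n (by omega)))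
        (C_mul_mem (Xg .t1) (ih (n + 1) (by omega)))
      convert this using 1
      simp only [sSeq]
      ring

theorem sSeq_mem_two (n : ℕ) : C (Xg .v) * sSeq n - C (Xg .p3) * sSeq (n + 1)
    - C (Xg .p4) * sSeq (n + 2) ∈ subPi ⊔ Submodule.span SG {1} := by
  induction n using Nat.strong_induction_on with
  | _ n ih =>
    match n with
    | 0 =>
      refine mem_sup_of_eq 1 ?_
      simp only [C_F0, F, polyF, Matrix.cons_val, sSeq]; ring
    | 1 =>
      refine mem_sup_of_eq 3 ?_
      simp only [C_F0, F, polyF, Matrix.cons_val, sSeq]; ring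
    | 2 =>
      refine mem_sup_of_eq 5 ?_
      simp only [C_F0, F, polyF, Matrix.cons_val, sSeq]; ring
    | n + 3 =>
      have := sub_mem (C_mul_mem (Xg .t2) (ih n (by omega)))
        (C_mul_mem (Xg .t1) (ih (n + 1) (by omega)))
      convert this using 1
      simp only [sSeq]
      ring

/-- Modulo `S_G` and `I_Π`, the functional `sFun` factors through `S̃_G`: the relations `f₁`
and `f₂` are respected by `F1, …, F6` and the cubic relation by the recursion of `sSeq`. -/
theorem sFun_mem_of_mem_relIdeal {p : Polynomial SG} (hp : p ∈ relIdeal) :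
    sFun p ∈ subPi ⊔ Submodule.span SG {1} := by
  suffices ∀ q, sFun (q * p) ∈ subPi ⊔ Submodule.span SG {1} by simpa using this 1
  have key : ∀ f : Polynomial SG,
      (∀ n, sFun (Polynomial.X ^ n * f) ∈ subPi ⊔ Submodule.span SG {1}) →
      ∀ q, sFun (q * f) ∈ subPi ⊔ Submodule.span SG {1} := by
    intro f hf q
    induction q using Polynomial.induction_on' with
    | add p q hp hq =>
      rw [add_mul, map_add]
      exact add_mem hp hq
    | monomial n a =>
      rw [← Polynomial.C_mul_X_pow_eq_monomial, mul_assoc, ← Polynomial.smul_eq_C_mul, map_smul]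
      exact Submodule.smul_mem _ _ (hf n)
  have hmon : ∀ (n : ℕ) (a : SG), sFun (Polynomial.X ^ n * Polynomial.C a) = C a * sSeq n := by
    intro n a
    rw [mul_comm, Polynomial.C_mul_X_pow_eq_monomial, sFun_monomial]
  induction hp using Submodule.span_induction with
  | mem x hx =>
    refine key x fun n => ?_
    rcases hx with rfl | rfl | rfl
    · convert sSeq_mem_one n using 1
      simp only [← hmon, ← map_sub]
      congr 1
      ring
    · convert sSeq_mem_two n using 1
      simp only [← hmon, ← map_sub]
      congr 1
      ring
    · convert zero_mem (subPi ⊔ Submodule.span SG {1}) using 1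
      have : C (1 : SG) * sSeq (n + 3) + C (Xg .t1) * sSeq (n + 1) - C (Xg .t2) * sSeq n = 0 := by
        simp only [sSeq, map_one]; ring
      rw [← this]
      simp only [← hmon, ← map_sub, ← map_add]
      congr 1
      rw [Polynomial.C_1]
      ring
  | zero => simp
  | add x y _ _ hx hy =>
    intro q
    rw [mul_add, map_add]
    exact add_mem (hx q) (hy q)
  | smul a x _ hx =>
    intro q
    rw [smul_eq_mul, ← mul_assoc]
    exact hx _

/-- An `S_G`-linear relation between `1, w, w²` in `S̃_G` holds, up to an element of `S_G`, between
`s1, s2, s3` in `R_Π`. -/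
theorem exists_sub_C_mem_IPi {a b c : SG} (habc : h a + Xn .w * h b + Xn .w ^ 2 * h c = 0) :
    ∃ r : SG, C a * Xs 0 + C b * Xs 1 + C c * Xs 2 - C r ∈ IPi := by
  have := sFun_mem_of_mem_relIdeal (mem_relIdeal_of_h_eq_zero habc)
  obtain ⟨y, hy, z, hz, hyz⟩ := Submodule.mem_sup.1 this
  obtain ⟨r, rfl⟩ := Submodule.mem_span_singleton.1 hz
  refine ⟨r, ?_⟩
  have h2 : sFun (Polynomial.C a + Polynomial.X * Polynomial.C b
      + Polynomial.X ^ 2 * Polynomial.C c) = C a * Xs 0 + C b * Xs 1 + C c * Xs 2 := by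
    rw [map_add, map_add, ← Polynomial.monomial_zero_left, Polynomial.X_mul_C,
      Polynomial.C_mul_X_eq_monomial, mul_comm, Polynomial.C_mul_X_pow_eq_monomial]
    simp only [sFun_monomial, sSeq]
  rw [← h2, ← hyz, MvPolynomial.smul_eq_C_mul, mul_one, add_sub_cancel_right]
  exact hy

/-! ### Normal forms in `R_Π` -/

/-- The `S_G`-submodule of `S_Π` spanned by `1` and the monomials `s1ⁱ sⱼ` with `i < n`. -/
noncomputable def filt : ℕ → Submodule SG SPi
  | 0 => Submodule.span SG {1}
  | n + 1 => filt n ⊔ Submodule.span SG (Set.range fun j : Fin 3 => Xs 0 ^ n * Xs j)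

theorem mem_filt_zero {f : SPi} : f ∈ filt 0 ↔ ∃ r : SG, C r = f := by
  simp [filt, Submodule.mem_span_singleton, MvPolynomial.smul_eq_C_mul]

theorem mem_filt_succ {n : ℕ} {f : SPi} : f ∈ filt (n + 1) ↔
    ∃ g ∈ filt n, ∃ c : Fin 3 → SG,
      f = g + Xs 0 ^ n * (C (c 0) * Xs 0 + C (c 1) * Xs 1 + C (c 2) * Xs 2) := by
  simp only [filt, Submodule.mem_sup, Submodule.mem_span_range_iff_exists_fun]
  constructor
  · rintro ⟨g, hg, _, ⟨c, rfl⟩, rfl⟩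
    refine ⟨g, hg, c, ?_⟩
    simp only [Fin.sum_univ_three, MvPolynomial.smul_eq_C_mul]
    ring
  · rintro ⟨g, hg, c, rfl⟩
    refine ⟨g, hg, _, ⟨c, rfl⟩, ?_⟩
    simp only [Fin.sum_univ_three, MvPolynomial.smul_eq_C_mul]
    ring

theorem filt_mono : Monotone filt :=
  monotone_nat_of_le_succ fun _ => le_sup_left

theorem X_zero_pow_mul_X_mem_filt (n : ℕ) (j : Fin 3) : Xs 0 ^ n * Xs j ∈ filt (n + 1) :=
  Submodule.mem_sup_right (Submodule.subset_span ⟨j, rfl⟩)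

theorem C_mem_filt (r : SG) (n : ℕ) : C r ∈ filt n :=
  filt_mono (Nat.zero_le n) (mem_filt_zero.2 ⟨r, rfl⟩)

theorem X_zero_pow_mem_filt (n : ℕ) : Xs 0 ^ n ∈ filt n := by
  cases n with
  | zero => simpa using C_mem_filt 1 0
  | succ n => simpa [pow_succ] using X_zero_pow_mul_X_mem_filt n 0

theorem X_zero_pow_mul_mem_filt (n : ℕ) {m : ℕ} {f : SPi} (hf : f ∈ filt m) :
    Xs 0 ^ n * f ∈ filt (m + n) := by
  induction m generalizing f with
  | zero =>
    obtain ⟨r, rfl⟩ := mem_filt_zero.1 hf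
    rw [mul_comm, zero_add]
    exact C_mul_mem r (X_zero_pow_mem_filt n)
  | succ m ih =>
    obtain ⟨g, hg, c, rfl⟩ := mem_filt_succ.1 hf
    rw [mul_add]
    refine add_mem (filt_mono (by omega) (ih hg)) ?_
    rw [add_right_comm, mem_filt_succ]
    refine ⟨0, zero_mem _, c, ?_⟩
    ring

/-- `F7, F8, F9` express the products of two of `s2, s3` by terms that are linear in `s2, s3`. -/
theorem X_mul_X_mem (j k : Fin 3) : Xs j * Xs k ∈ filt 2 ⊔ subPi := by
  have hs : ∀ j, (Xs 0 * Xs j : SPi) ∈ filt 2 := fun j => by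
    simpa using X_zero_pow_mul_X_mem_filt 1 j
  have hl : ∀ j, (Xs j : SPi) ∈ filt 2 := fun j =>
    filt_mono one_le_two (by simpa using X_zero_pow_mul_X_mem_filt 0 j)
  have h11 : Xs 1 * Xs 1 ∈ filt 2 ⊔ subPi := by
    have h1 := add_mem (sub_mem (add_mem (hs 2)
      (C_mul_mem (Xg .L123 * Xg .p2 + Xg .L124 * Xg .p4) (hl 0)))
      (C_mul_mem (Xg .L125 * Xg .p2 + Xg .L126 * Xg .p4) (hl 1))) (C_mem_filt (F0 6) 2)
    have h2 := sub_mem (Submodule.mem_sup_left (T := subPi) h1)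
      (Submodule.mem_sup_right (S := filt 2) (mem_subPi.2 (F_mem 6)))
    convert h2 using 1
    rw [C_F0]
    simp only [F, polyF, Matrix.cons_val, map_add, map_mul]
    ring
  have h12 : Xs 1 * Xs 2 ∈ filt 2 ⊔ subPi := by
    have h1 := sub_mem (sub_mem (sub_mem (add_mem (sub_mem
      (C_mul_mem (Xg .t2) (hs 0)) (C_mul_mem (Xg .t1) (hs 1)))
      (C_mul_mem (Xg .L125 * Xg .p1 + Xg .L126 * Xg .p3) (hl 1)))
      (C_mul_mem (Xg .L123 * Xg .p1 + Xg .L124 * Xg .p3) (hl 0))) (C_mem_filt (F0 7) 2))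
      (zero_mem (filt 2))
    have h2 := add_mem (Submodule.mem_sup_left (T := subPi) h1)
      (Submodule.mem_sup_right (S := filt 2) (mem_subPi.2 (F_mem 7)))
    convert h2 using 1
    rw [C_F0]
    simp only [F, polyF, Matrix.cons_val, map_add, map_mul]
    ring
  have h22 : Xs 2 * Xs 2 ∈ filt 2 ⊔ subPi := by
    have h1 := sub_mem (add_mem (sub_mem (C_mul_mem (Xg .t2) (hs 1))
      (C_mul_mem (Xg .L123 * Xg .u + Xg .L124 * Xg .v) (hl 0)))
      (C_mul_mem (Xg .L125 * Xg .u + Xg .L126 * Xg .v) (hl 1))) (C_mem_filt (F0 8) 2)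
    have h2 := sub_mem (add_mem (Submodule.mem_sup_left (T := subPi) h1)
      (Submodule.mem_sup_right (S := filt 2) (mem_subPi.2 (F_mem 8)))) (C_mul_mem (Xg .t1) h11)
    convert h2 using 1
    rw [C_F0]
    simp only [F, polyF, Matrix.cons_val, map_add, map_mul]
    ring
  fin_cases j
  · exact Submodule.mem_sup_left (hs k)
  · fin_cases k
    · exact Submodule.mem_sup_left (mul_comm (Xs 0 : SPi) (Xs 1) ▸ hs 1)
    · exact h11
    · exact h12
  · fin_cases k
    · exact Submodule.mem_sup_left (mul_comm (Xs 0 : SPi) (Xs 2) ▸ hs 2)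
    · exact mul_comm (Xs 1 : SPi) (Xs 2) ▸ h12
    · exact h22

theorem mul_mem_sup_subPi {S T : Submodule SG SPi} (p : SPi) (h : ∀ f ∈ S, p * f ∈ T ⊔ subPi)
    {f : SPi} (hf : f ∈ S ⊔ subPi) : p * f ∈ T ⊔ subPi := by
  obtain ⟨y, hy, z, hz, rfl⟩ := Submodule.mem_sup.1 hf
  rw [mul_add]
  exact add_mem (h y hy) (Submodule.mem_sup_right (IPi.mul_mem_left p hz))

theorem mul_X_mem_filt_succ (j : Fin 3) {n : ℕ} {f : SPi} (hf : f ∈ filt n) :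
    Xs j * f ∈ filt (n + 1) ⊔ subPi := by
  induction n generalizing f with
  | zero =>
    obtain ⟨r, rfl⟩ := mem_filt_zero.1 hf
    rw [mul_comm]
    exact Submodule.mem_sup_left
      (C_mul_mem r (by simpa using X_zero_pow_mul_X_mem_filt 0 j))
  | succ n ih =>
    obtain ⟨g, hg, c, rfl⟩ := mem_filt_succ.1 hf
    have hk : ∀ k, Xs 0 ^ n * (Xs j * Xs k) ∈ filt (n + 2) ⊔ subPi := fun k =>
      mul_mem_sup_subPi (S := filt 2) _ (fun f hf => Submodule.mem_sup_left
        (filt_mono (by omega) (X_zero_pow_mul_mem_filt n hf))) (X_mul_X_mem j k)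
    have hg' : Xs j * g ∈ filt (n + 2) ⊔ subPi :=
      sup_le_sup_right (filt_mono (by omega)) _ (ih hg)
    have := add_mem hg' (add_mem (add_mem (C_mul_mem (c 0) (hk 0)) (C_mul_mem (c 1) (hk 1)))
      (C_mul_mem (c 2) (hk 2)))
    convert this using 1
    ring

/-- Every element of `R_Π` has a representative in normal form. -/
theorem exists_mem_filt_sup_subPi (f : SPi) : ∃ n, f ∈ filt n ⊔ subPi := by
  induction f using MvPolynomial.induction_on with
  | C a => exact ⟨0, Submodule.mem_sup_left (C_mem_filt a 0)⟩
  | add p q hp hq =>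
    obtain ⟨m, hm⟩ := hp
    obtain ⟨n, hn⟩ := hq
    exact ⟨max m n, add_mem (sup_le_sup_right (filt_mono (le_max_left m n)) _ hm)
      (sup_le_sup_right (filt_mono (le_max_right m n)) _ hn)⟩
  | mul_X p j hp =>
    obtain ⟨n, hn⟩ := hp
    refine ⟨n + 1, ?_⟩
    rw [mul_comm]
    exact mul_mem_sup_subPi _ (fun f hf => mul_X_mem_filt_succ j hf) hn

theorem C_G'_mem_IPi : C G' ∈ IPi := by
  have h1 : (C G' : SPi) = _ := (map_polyG' C _ _ _ _ _ _ _ _ _ _ _ _ _ _ _ _).trans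
    (polyG'_eq_combination _ _ _ _ _ _ _ _ _ _ _ _ _ _ _ _ (Xs 0) (Xs 1) (Xs 2))
  rw [h1]
  have hF := F_mem
  simp only [F] at hF
  refine neg_mem (sub_mem (sub_mem (sub_mem ?_ ?_) ?_) (sub_mem (sub_mem ?_ ?_) ?_))
  all_goals
    first
    | exact IPi.mul_mem_left _ (hF _)
    | exact IPi.mul_mem_left _
        (sub_mem (IPi.mul_mem_left _ (hF _)) (IPi.mul_mem_left _ (hF _)))

/-! ### A nonzerodivisor -/

theorem polyG'_translate {B : Type*} [CommRing B] (p1 p2 p3 p4 u v t1 t2 L123 L124 L125 L126 L135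
  L136 L245 L246 : B) :
    ∃ c₁ c₂ c₃ : B, polyG' (A := Polynomial B) (.C p1) (.C p2) (.C p3) (.C p4) (.C u) (.C v + .X)
      (.C t1)
      (.C t2) (.C L123) (.C L124) (.C L125) (.C L126) (.C L135) (.C L136) (.C L245)
      (.C L246 + .X) =
    Polynomial.X ^ 4 + (.C c₃ * Polynomial.X ^ 3 + .C c₂ * Polynomial.X ^ 2 + .C c₁ * Polynomial.X
      + .C (polyG' p1 p2 p3 p4 u v t1 t2 L123 L124 L125 L126 L135 L136 L245 L246)) := by
  refine ⟨p1 ^ 2 * t1 * L136 - p1 ^ 2 * L123 - 3 * p1 * p2 * t2 * L136 + 2 * p1 * p3 * t1 * L245 -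
    p1 * p3 * L124 + p1 * p4 * t1 * L126 - 3 * p1 * p4 * t2 * L245 + p1 * u * L125 + 2 * p1 * v *
    L126 + p2 ^ 2 * t1 ^ 2 * L136 - p2 ^ 2 * t1 * L123 + p2 ^ 2 * t2 * L125 - p2 * p3 * t1 * L126
    - 3 * p2 * p3 * t2 * L245 + 2 * p2 * p4 * t1 ^ 2 * L245 - p2 * p4 * t1 * L124 + p2 * p4 * t2 *
    L126 + 4 * p2 * u * t1 * L136 - p2 * u * L123 + 4 * p2 * v * t1 * L245 - 2 * p2 * v * L124 -
    p3 ^ 3 * t2 + p3 ^ 2 * v * t1 + p3 ^ 2 * t1 * L246 - p3 * p4 ^ 2 * t1 * t2 - 3 * p3 * p4 * v *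
    t2 - 3 * p3 * p4 * t2 * L246 - p3 * u * L126 - p4 ^ 3 * t2 ^ 2 + p4 ^ 2 * v * t1 ^ 2 + p4 ^ 2
    * t1 ^ 2 * L246 + 4 * p4 * u * t1 * L245 + p4 * u * L124 + 2 * p4 * v ^ 2 * t1 + 4 * p4 * v *
    t1 * L246 + 3 * u ^ 2 * L136 + 6 * u * v * L245 + v ^ 3 + 3 * v ^ 2 * L246,
    p1 * L126 + 2 * p2 * t1 * L245 - p2 * L124 + p3 ^ 2 * t1 - 3 * p3 * p4 * t2 + p4 ^ 2 * t1 ^ 2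
      + 4 * p4 * v * t1 + 2 * p4 * t1 * L246 + 3 * u * L245 + 3 * v ^ 2 + 3 * v * L246,
    2 * p4 * t1 + 3 * v + L246, ?_⟩
  simp only [polyG'_eq, minor_123, minor_124, minor_125, minor_126, minor_135, minor_136,
    minor_145, minor_146, minor_245, minor_246, map_add, map_sub, map_mul, map_neg, map_pow,
    map_ofNat]
  ring

section Translate

variable {B : Type*} [CommRing B] (π : SG →+* B)

/-- The composition of `π` with the translation `v ↦ v + X`, `L246 ↦ L246 + X`. -/
noncomputable def translate : SG →+* Polynomial B :=
  eval₂Hom ((Polynomial.C.comp π).comp C) fun i : VarG => match i with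
    | .v => Polynomial.C (π (Xg .v)) + Polynomial.X
    | .L246 => Polynomial.C (π (Xg .L246)) + Polynomial.X
    | i => Polynomial.C (π (X i))

theorem eval_translate (a : SG) : (translate π a).eval 0 = π a := by
  have : (Polynomial.evalRingHom 0).comp (translate π) = π := by
    refine MvPolynomial.ringHom_ext (fun r => ?_) fun i => ?_
    · simp [translate]
    · cases i <;> simp [translate]
  exact DFunLike.congr_fun this a

theorem monic_translate_G' : (translate π G').Monic := by
  obtain ⟨c₁, c₂, c₃, hc⟩ := polyG'_translate (π (Xg .p1)) (π (Xg .p2)) (π (Xg .p3)) (π (Xg .p4))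
    (π (Xg .u)) (π (Xg .v)) (π (Xg .t1)) (π (Xg .t2)) (π (Xg .L123)) (π (Xg .L124)) (π (Xg .L125))
    (π (Xg .L126)) (π (Xg .L135)) (π (Xg .L136)) (π (Xg .L245)) (π (Xg .L246))
  rw [G', map_polyG']
  simp only [translate, eval₂Hom_X']
  rw [hc]
  exact Polynomial.monic_X_pow_add Polynomial.degree_cubic_lt

/-- The polynomial `G` is a nonzerodivisor modulo `p1 p4 - p2 p3` and `D135`: these do not involve
`v` and `L246`, in which `G` has the leading term `L246 v³`. -/
theorem eq_zero_of_map_G'_mul_eq_zero (hdet : π det = 0) (hmin : π (minor matSG 1 3 5) = 0)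
    (hπ : ∀ a, π a = 0 → a ∈ Ideal.span {det, minor matSG 1 3 5}) {e : SG}
    (he : π (G' * e) = 0) : π e = 0 := by
  have hdet' : translate π det = 0 := by
    have : translate π det = Polynomial.C (π det) := by simp [translate, det]
    rw [this, hdet, map_zero]
  have hmin' : translate π (minor matSG 1 3 5) = 0 := by
    have : translate π (minor matSG 1 3 5) = Polynomial.C (π (minor matSG 1 3 5)) := by
      rw [matSG, map_minor_matM, map_minor_matM, map_minor_matM, minor_135, minor_135]
      simp only [translate, eval₂Hom_X']
    rw [this, hmin, map_zero]
  have h0 : translate π (G' * e) = 0 := by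
    obtain ⟨a, b, hab⟩ := Ideal.mem_span_pair.1 (hπ _ he)
    rw [← hab, map_add, map_mul, map_mul, hdet', hmin', mul_zero, mul_zero, add_zero]
  rw [map_mul, (monic_translate_G' π).mul_right_eq_zero_iff] at h0
  rw [← eval_translate, h0, Polynomial.eval_zero]

end Translate

theorem mem_of_G'_mul_mem {e : SG} (he : G' * e ∈ Ideal.span {det, minor matSG 1 3 5}) :
    e ∈ Ideal.span {det, minor matSG 1 3 5} := by
  rw [← Ideal.Quotient.eq_zero_iff_mem] at he ⊢
  refine eq_zero_of_map_G'_mul_eq_zero _ ?_ ?_ (fun a => Ideal.Quotient.eq_zero_iff_mem.1) he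
  · exact Ideal.Quotient.eq_zero_iff_mem.2 (Ideal.subset_span (Or.inl rfl))
  · exact Ideal.Quotient.eq_zero_iff_mem.2 (Ideal.subset_span (Or.inr rfl))

/-! ### The kernel of a map to a field -/

theorem minor_123_mul_sub_mem :
    C (minor matSG 1 2 3) * Xs 0
      - C (-(F0 0 * (Xg .p1 * Xg .p3 + Xg .p4 * (Xg .u + Xg .t1 * Xg .p2))
        + Xg .p1 * (-(Xg .p1 * F0 1) + Xg .p4 * F0 2)
        - Xg .p2 * (F0 1 * (Xg .u + Xg .t1 * Xg .p2) + Xg .p3 * F0 2))) ∈ IPi := by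
  have h := IPi.sub_mem (IPi.add_mem
    (IPi.mul_mem_left (C (Xg .p1 * Xg .p3 + Xg .p4 * (Xg .u + Xg .t1 * Xg .p2))) (F_mem 0))
    (IPi.add_mem (IPi.mul_mem_left (C (-(Xg .p1 * Xg .p1))) (F_mem 1))
      (IPi.mul_mem_left (C (Xg .p1 * Xg .p4)) (F_mem 2))))
    (IPi.add_mem (IPi.mul_mem_left (C (Xg .p2 * (Xg .u + Xg .t1 * Xg .p2))) (F_mem 1))
      (IPi.mul_mem_left (C (Xg .p2 * Xg .p3)) (F_mem 2)))
  convert h using 1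
  rw [matSG, minor_123]
  simp only [map_add, map_sub, map_mul, map_neg, map_pow, C_F0]
  simp only [F, polyF, Matrix.cons_val]
  ring

theorem h_surj (κ : SN) : ∃ a b c : SG, κ = h a + Xn .w * h b + Xn .w ^ 2 * h c := by
  induction κ using MvPolynomial.induction_on with
  | C r => exact ⟨C r, 0, 0, by simp [h]⟩
  | add p q hp hq =>
    obtain ⟨a, b, c, rfl⟩ := hp
    obtain ⟨a', b', c', rfl⟩ := hq
    exact ⟨a + a', b + b', c + c', by simp only [map_add]; ring⟩
  | mul_X p i hp =>
    obtain ⟨a, b, c, rfl⟩ := hp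
    have key : ∀ y : SG, h y = X i → ∃ a' b' c' : SG, (h a + Xn .w * h b + Xn .w ^ 2 * h c) * X i =
        h a' + Xn .w * h b' + Xn .w ^ 2 * h c' := fun y hy =>
      ⟨a * y, b * y, c * y, by simp only [map_mul, hy]; ring⟩
    cases i
    case w =>
      refine ⟨c * Xg .t2, a - c * Xg .t1, b, ?_⟩
      simp only [map_mul, map_sub, h_X_t1, h_X_t2]
      ring
    case p1 => exact key (Xg .p1) (by simp)
    case p2 => exact key (Xg .p2) (by simp)
    case p3 => exact key (Xg .p3) (by simp)
    case p4 => exact key (Xg .p4) (by simp)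
    case t1 => exact key (Xg .t1) (by simp)
    case L123 => exact key (Xg .L123) (by simp)
    case L124 => exact key (Xg .L124) (by simp)
    case L125 => exact key (Xg .L125) (by simp)
    case L126 => exact key (Xg .L126) (by simp)
    case L135 => exact key (Xg .L135) (by simp)
    case L136 => exact key (Xg .L136) (by simp)
    case L245 => exact key (Xg .L245) (by simp)
    case L246 => exact key (Xg .L246) (by simp)

section Field

variable {K : Type*} [Field K] {φ : SPi →+* K}

theorem map_eq_zero_of_mem_IPi (hF : ∀ i, φ (F i) = 0) {f : SPi} (hf : f ∈ IPi) : φ f = 0 := by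
  have : IPi ≤ RingHom.ker φ := Ideal.span_le.2 (by rintro _ ⟨i, rfl⟩; exact hF i)
  exact this hf

theorem map_eq_of_sub_mem_IPi (hF : ∀ i, φ (F i) = 0) {f g : SPi} (hf : f - g ∈ IPi) :
    φ f = φ g := by
  rw [← sub_eq_zero, ← map_sub]
  exact map_eq_zero_of_mem_IPi hF hf

theorem h_eq_zero_of_map_eq_zero (hker : ∀ a : SG, φ (C a) = 0 → G' ∣ a) {a : SG}
    (ha : φ (C a) = 0) : h a = 0 := by
  obtain ⟨b, rfl⟩ := hker a ha
  rw [map_mul, RingHom.mem_ker.1 G'_mem_ID, zero_mul]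

theorem h_eq_of_map_eq (hker : ∀ a : SG, φ (C a) = 0 → G' ∣ a) {a b : SG}
    (hab : φ (C a) = φ (C b)) : h a = h b := by
  rw [← sub_eq_zero, ← map_sub]
  exact h_eq_zero_of_map_eq_zero hker (by rw [map_sub, map_sub, hab, sub_self])

/-- Multiplication by `s1, s2, s3` maps `I_D` to the image of `S_G`, and modulo `I_D` the three
products are in the ratio `1 : w : w²`. -/
theorem exists_mul_X (hF : ∀ i, φ (F i) = 0) (hker : ∀ a : SG, φ (C a) = 0 → G' ∣ a) {x : SG}
    (hx : x ∈ ID) : ∃ Y : Fin 3 → SG, (∀ j, φ (C x) * φ (Xs j) = φ (C (Y j))) ∧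
      h (Y 1) = Xn .w * h (Y 0) ∧ h (Y 2) = Xn .w ^ 2 * h (Y 0) := by
  have hx0 : h x = 0 := hx
  obtain ⟨r₀, h₀⟩ := exists_sub_C_mem_IPi (a := x) (b := 0) (c := 0) (by simp [hx0])
  obtain ⟨r₁, h₁⟩ := exists_sub_C_mem_IPi (a := 0) (b := x) (c := 0) (by simp [hx0])
  obtain ⟨r₂, h₂⟩ := exists_sub_C_mem_IPi (a := 0) (b := 0) (c := x) (by simp [hx0])
  have e₀ := map_eq_of_sub_mem_IPi hF h₀
  have e₁ := map_eq_of_sub_mem_IPi hF h₁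
  have e₂ := map_eq_of_sub_mem_IPi hF h₂
  simp only [map_mul, map_zero, zero_mul, add_zero, zero_add] at e₀ e₁ e₂
  have k₁ : h (Xg .u * r₀ - Xg .p1 * r₁ - Xg .p2 * r₂ + x * F0 0) = 0 := by
    refine h_eq_zero_of_map_eq_zero hker ?_
    have : φ (C x * F 0) = 0 := by rw [map_mul, hF, mul_zero]
    rw [← this]
    have hF' : F 0 = C (Xg .u) * Xs 0 - C (Xg .p1) * Xs 1 - C (Xg .p2) * Xs 2 + C (F0 0) := by
      rw [C_F0]
      simp only [F, polyF, Matrix.cons_val]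
      ring
    rw [hF']
    simp only [map_add, map_sub, map_mul, ← e₀, ← e₁, ← e₂]
    ring
  have k₂ : h (Xg .v * r₀ - Xg .p3 * r₁ - Xg .p4 * r₂ + x * F0 1) = 0 := by
    refine h_eq_zero_of_map_eq_zero hker ?_
    have : φ (C x * F 1) = 0 := by rw [map_mul, hF, mul_zero]
    rw [← this]
    have hF' : F 1 = C (Xg .v) * Xs 0 - C (Xg .p3) * Xs 1 - C (Xg .p4) * Xs 2 + C (F0 1) := by
      rw [C_F0]
      simp only [F, polyF, Matrix.cons_val]
      ring
    rw [hF']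
    simp only [map_add, map_sub, map_mul, ← e₀, ← e₁, ← e₂]
    ring
  simp only [map_add, map_sub, map_mul, hx0, zero_mul, add_zero, h_X_u, h_X_v, h_X_p1, h_X_p2,
    h_X_p3, h_X_p4] at k₁ k₂
  refine ⟨![r₀, r₁, r₂], ?_, ?_, ?_⟩
  · intro j
    fin_cases j
    · exact e₀
    · exact e₁
    · exact e₂
  · refine mul_left_cancel₀ prime_detN.ne_zero ?_
    simp only [Matrix.cons_val, detN]
    linear_combination Xn .p2 * k₂ - Xn .p4 * k₁
  · refine mul_left_cancel₀ prime_detN.ne_zero ?_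
    simp only [Matrix.cons_val, detN]
    linear_combination Xn .p3 * k₁ - Xn .p1 * k₂

/-- For the element `D123` of `I_D` the product with `s1` is not in `I_D`, and it does not even
vanish on the divisor `p1 p4 - p2 p3 = 0` of `D`. -/
theorem not_detN_dvd (hF : ∀ i, φ (F i) = 0) (hker : ∀ a : SG, φ (C a) = 0 → G' ∣ a) {y : SG}
    (hy : φ (C (minor matSG 1 2 3)) * φ (Xs 0) = φ (C y)) : ¬ detN ∣ h y := by
  have := map_eq_of_sub_mem_IPi hF minor_123_mul_sub_mem
  rw [map_mul, hy] at this
  rw [h_eq_of_map_eq hker this]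
  set e : VarN → ℂ := fun | .p1 => 1 | .L135 => 1 | _ => 0 with he
  refine not_dvd_of_eval e (by simp [detN, he]) ?_
  -- The coefficient of `L135` in `h y` is `(p1² + w p1 p2 + (w² + t1) p2²)²`.
  have hF0 : ∀ i, eval e (h (F0 i)) =
      polyF (A := ℂ) 1 0 0 0 0 0 0 0 0 0 0 0 1 0 0 0 0 0 0 i := by
    intro i
    rw [F0, ← AlgHom.coe_toRingHom, map_polyF, map_polyF]
    simp [he]
  simp only [map_add, map_sub, map_mul, map_neg, hF0, h_X_p1, h_X_p2, h_X_p3, h_X_p4, h_X_t1,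
    eval_X]
  simp [he, polyF]

/-- Elements of `filt n` have a pole of order at most `n` along `D`. -/
theorem exists_pow_mul_eq {x : SG} {Y : Fin 3 → SG}
    (hY : ∀ j, φ (C x) * φ (Xs j) = φ (C (Y j))) {n : ℕ} {f : SPi} (hf : f ∈ filt n) :
    ∃ r, φ (C x) ^ n * φ f = φ (C r) := by
  induction n generalizing f with
  | zero =>
    obtain ⟨r, rfl⟩ := mem_filt_zero.1 hf
    exact ⟨r, by simp⟩
  | succ n ih =>
    obtain ⟨g, hg, c, rfl⟩ := mem_filt_succ.1 hf
    obtain ⟨r, hr⟩ := ih hg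
    refine ⟨x * r + Y 0 ^ n * (c 0 * Y 0 + c 1 * Y 1 + c 2 * Y 2), ?_⟩
    simp only [map_add, map_mul, map_pow, ← hr, ← hY]
    ring

/-- A polynomial that vanishes in `K` has, in normal form, leading coefficient
`c₀ + c₁ w + c₂ w² = 0` in `S̃_G`, so that its degree in `s1, s2, s3` can be lowered. -/
theorem mem_IPi_of_mem_filt (hF : ∀ i, φ (F i) = 0) (hker : ∀ a : SG, φ (C a) = 0 → G' ∣ a)
    {n : ℕ} {f : SPi} (hf : f ∈ filt n) (h0 : φ f = 0) : f ∈ IPi := by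
  induction n generalizing f with
  | zero =>
    obtain ⟨r, rfl⟩ := mem_filt_zero.1 hf
    obtain ⟨b, rfl⟩ := hker r h0
    rw [map_mul]
    exact IPi.mul_mem_right _ C_G'_mem_IPi
  | succ n ih =>
    obtain ⟨g, hg, c, rfl⟩ := mem_filt_succ.1 hf
    obtain ⟨Y, hY, hY1, hY2⟩ := exists_mul_X hF hker minor_123_mem_ID
    obtain ⟨r, hr⟩ := exists_pow_mul_eq hY hg
    have h1 : h (minor matSG 1 2 3 * r + Y 0 ^ n * (c 0 * Y 0 + c 1 * Y 1 + c 2 * Y 2)) = 0 := by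
      refine h_eq_zero_of_map_eq_zero hker ?_
      rw [← mul_zero (φ (C (minor matSG 1 2 3)) ^ (n + 1)), ← h0]
      simp only [map_add, map_mul, map_pow, ← hr, ← hY]
      ring
    have hY0 : h (Y 0) ≠ 0 := fun h0 =>
      not_detN_dvd hF hker (hY 0) (h0 ▸ dvd_zero _)
    have h2 : h (c 0) + Xn .w * h (c 1) + Xn .w ^ 2 * h (c 2) = 0 := by
      refine mul_left_cancel₀ (pow_ne_zero (n + 1) hY0) ?_
      simp only [map_add, map_mul, map_pow, RingHom.mem_ker.1 minor_123_mem_ID, hY1, hY2] at h1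
      linear_combination h1
    obtain ⟨t, ht⟩ := exists_sub_C_mem_IPi h2
    have h3 : g + Xs 0 ^ n * (C (c 0) * Xs 0 + C (c 1) * Xs 1 + C (c 2) * Xs 2)
        - (g + C t * Xs 0 ^ n) ∈ IPi := by
      convert IPi.mul_mem_left (Xs 0 ^ n) ht using 1
      ring
    rw [← sub_add_cancel (g + Xs 0 ^ n * (C (c 0) * Xs 0 + C (c 1) * Xs 1 + C (c 2) * Xs 2))
      (g + C t * Xs 0 ^ n)]
    refine IPi.add_mem h3 (ih (add_mem hg (C_mul_mem t (X_zero_pow_mem_filt n))) ?_)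
    rw [← map_eq_of_sub_mem_IPi hF h3, h0]

theorem ker_eq_IPi (hF : ∀ i, φ (F i) = 0) (hker : ∀ a : SG, φ (C a) = 0 → G' ∣ a) :
    RingHom.ker φ = IPi := by
  refine le_antisymm (fun f hf => ?_) fun f hf => map_eq_zero_of_mem_IPi hF hf
  obtain ⟨n, hn⟩ := exists_mem_filt_sup_subPi f
  obtain ⟨y, hy, z, hz, rfl⟩ := Submodule.mem_sup.1 hn
  refine IPi.add_mem (mem_IPi_of_mem_filt hF hker hy ?_) hz
  rw [RingHom.mem_ker, map_add, map_eq_zero_of_mem_IPi hF hz, add_zero] at hf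
  exact hf

/-! ### The inverse of `J_D` -/

theorem map_C_G' (hF : ∀ i, φ (F i) = 0) : φ (C G') = 0 :=
  map_eq_zero_of_mem_IPi hF C_G'_mem_IPi

/-- A rational function that can be written with either of the denominators `p1 p4 - p2 p3` and
`D135` lies in the image of `S_G`, because `p1 p4 - p2 p3, D135, G` is a regular sequence. -/
theorem exists_eq_of_det_mul (hF : ∀ i, φ (F i) = 0) (hker : ∀ a : SG, φ (C a) = 0 → G' ∣ a)
    {g : K} {m r : SG} (hm : φ (C det) * g = φ (C m))
    (hr : φ (C (minor matSG 1 3 5)) * g = φ (C r)) : ∃ n, g = φ (C n) := by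
  obtain ⟨e, he⟩ : G' ∣ minor matSG 1 3 5 * m - det * r := by
    refine hker _ ?_
    simp only [map_sub, map_mul, ← hm, ← hr]
    ring
  obtain ⟨a, b, hab⟩ := Ideal.mem_span_pair.1 (mem_of_G'_mul_mem (e := e) (by
    rw [← he]
    exact sub_mem (Ideal.mul_mem_right _ _ (Ideal.subset_span (Or.inr rfl)))
      (Ideal.mul_mem_right _ _ (Ideal.subset_span (Or.inl rfl)))))
  have hdvd : det ∣ minor matSG 1 3 5 * (m - G' * b) :=
    ⟨r + G' * a, by linear_combination he - G' * hab⟩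
  obtain ⟨n, hn⟩ := (prime_det.dvd_or_dvd hdvd).resolve_left not_det_dvd_minor_135
  have hdet : φ (C det) ≠ 0 := fun h0 => not_G'_dvd_det (hker _ h0)
  refine ⟨n, mul_left_cancel₀ hdet ?_⟩
  rw [hm, ← map_mul, ← map_mul, ← hn, map_sub, map_sub, map_mul, map_mul, map_C_G' hF, zero_mul,
    sub_zero]

theorem exists_eq_of_det_pow_mul (hF : ∀ i, φ (F i) = 0)
    (hker : ∀ a : SG, φ (C a) = 0 → G' ∣ a) (k : ℕ) {g : K} {m r : SG}
    (hm : φ (C det) ^ k * g = φ (C m)) (hr : φ (C (minor matSG 1 3 5)) * g = φ (C r)) :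
    ∃ n, g = φ (C n) := by
  induction k generalizing m with
  | zero => exact ⟨m, by simpa using hm⟩
  | succ k ih =>
    obtain ⟨n, hn⟩ := exists_eq_of_det_mul hF hker (g := φ (C det) ^ k * g) (m := m)
      (r := det ^ k * r) (by rw [← hm]; ring)
      (by simp only [map_mul, map_pow, ← hr]; ring)
    exact ih hn

theorem map_polyF_eq_zero (hF : ∀ i, φ (F i) = 0) (i : Fin 9) :
    polyF (φ (C (Xg .p1))) (φ (C (Xg .p2))) (φ (C (Xg .p3))) (φ (C (Xg .p4))) (φ (C (Xg .u)))
      (φ (C (Xg .v))) (φ (C (Xg .t1))) (φ (C (Xg .t2))) (φ (C (Xg .L123))) (φ (C (Xg .L124)))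
      (φ (C (Xg .L125))) (φ (C (Xg .L126))) (φ (C (Xg .L135))) (φ (C (Xg .L136))) (φ (C (Xg .L245)))
      (φ (C (Xg .L246))) (φ (Xs 0)) (φ (Xs 1)) (φ (Xs 2)) i = 0 := by
  rw [← map_polyF, ← hF i]
  rfl

/-- Away from `p1 p4 - p2 p3 = 0` the ideal of `D` is generated by the regular sequence `b1, b2`,
and the elements of `J_D⁻¹` are combinations of `1` and `s1`. -/
theorem exists_det_cube_mul_eq (hF : ∀ i, φ (F i) = 0)
    (hker : ∀ a : SG, φ (C a) = 0 → G' ∣ a) {f : K}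
    (hf : ∀ a ∈ ID, ∃ r, f * φ (C a) = φ (C r)) :
    ∃ m q : SG, φ (C det) ^ 3 * f = φ (C m) + φ (C q) * φ (Xs 0) := by
  obtain ⟨r₁, h₁⟩ := hf b1 b1_mem_ID
  obtain ⟨r₂, h₂⟩ := hf b2 b2_mem_ID
  obtain ⟨q, hq⟩ : G' ∣ b1 * r₂ - b2 * r₁ := by
    refine hker _ ?_
    simp only [map_sub, map_mul, ← h₁, ← h₂]
    ring
  set q1 : SG := mulRelOne (Xg .p1) (Xg .p2) (Xg .p3) (Xg .p4) (Xg .u) (Xg .v) (Xg .t1) (Xg .t2)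
    (Xg .L123) (Xg .L124) (Xg .L125) (Xg .L126) (Xg .L135) (Xg .L136) (Xg .L245) (Xg .L246) with hq1
  set q2 : SG := mulRelTwo (Xg .p1) (Xg .p2) (Xg .p3) (Xg .p4) (Xg .u) (Xg .v) (Xg .t1) (Xg .t2)
    (Xg .L123) (Xg .L124) (Xg .L125) (Xg .L126) (Xg .L135) (Xg .L136) (Xg .L245) (Xg .L246) with hq2
  have hG : det ^ 3 * G' = b1 * q2 - b2 * q1 := det_cube_mul_polyG' ..
  have hs2 : φ (Xs 0) * φ (C b2) = φ (C q2) := by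
    have := mul_relTwo_of_polyF_eq_zero _ _ _ _ _ _ _ _ _ _ _ _ _ _ _ _ _ _ _
      (map_polyF_eq_zero hF)
    convert this using 1
    · simp only [b2, relTwo, map_add, map_sub, map_mul, map_pow]
    · have := fun i => map_polyF (φ.comp C) (Xg .p1) (Xg .p2) (Xg .p3) (Xg .p4) (Xg .u)
        (Xg .v) (Xg .t1) (Xg .t2) (Xg .L123) (Xg .L124) (Xg .L125) (Xg .L126) (Xg .L135) (Xg .L136)
        (Xg .L245) (Xg .L246) 0 0 0 i
      simp only [RingHom.comp_apply, map_zero] at this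
      simp only [hq2, mulRelTwo, map_add, map_sub, map_mul, this]
  have hdvd : b2 ∣ b1 * (det ^ 3 * r₂ - q * q2) :=
    ⟨det ^ 3 * r₁ - q * q1, by linear_combination det ^ 3 * hq + q * hG⟩
  obtain ⟨m, hm⟩ := (prime_b2.dvd_or_dvd hdvd).resolve_left not_b2_dvd_b1
  have hb2 : φ (C b2) ≠ 0 := fun h0 => not_G'_dvd_b2 (hker _ h0)
  refine ⟨m, q, mul_right_cancel₀ hb2 ?_⟩
  have hm' := congrArg (fun a => φ (C a)) hm
  simp only [map_sub, map_mul, map_pow, ← h₂, ← hs2] at hm'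
  linear_combination hm'

theorem exists_map_eq_of_mul_mem (hF : ∀ i, φ (F i) = 0)
    (hker : ∀ a : SG, φ (C a) = 0 → G' ∣ a) {f : K}
    (hf : ∀ a ∈ ID, ∃ r, f * φ (C a) = φ (C r)) : ∃ g, φ g = f := by
  obtain ⟨m, q, hmq⟩ := exists_det_cube_mul_eq hF hker hf
  obtain ⟨Y, hY, -, -⟩ := exists_mul_X hF hker minor_123_mem_ID
  obtain ⟨r, hr⟩ := hf _ minor_123_mem_ID
  have h1 : h (det ^ 3 * r) = h (minor matSG 1 2 3 * m + q * Y 0) := by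
    refine h_eq_of_map_eq hker ?_
    simp only [map_add, map_mul, map_pow, ← hr, ← hY]
    linear_combination φ (C (minor matSG 1 2 3)) * hmq
  simp only [map_add, map_mul, map_pow, RingHom.mem_ker.1 minor_123_mem_ID, zero_mul, zero_add,
    h_det] at h1
  -- `h q / detN ^ 3` is the ratio of the residues of `f` and `s1` along `D`.
  obtain ⟨κ, hκ⟩ := prime_detN.pow_dvd_of_dvd_mul_right 3 (not_detN_dvd hF hker (hY 0))
    ⟨h r, h1.symm⟩
  obtain ⟨a, b, c, rfl⟩ := h_surj κ
  obtain ⟨r₀, hr₀⟩ := exists_sub_C_mem_IPi (a := q - det ^ 3 * a) (b := -(det ^ 3 * b))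
    (c := -(det ^ 3 * c)) (by
      simp only [map_sub, map_neg, map_mul, map_pow, h_det, hκ]
      ring)
  have e₀ := map_eq_of_sub_mem_IPi hF hr₀
  simp only [map_add, map_sub, map_neg, map_mul, map_pow] at e₀
  obtain ⟨Z, hZ, -, -⟩ := exists_mul_X hF hker minor_135_mem_ID
  obtain ⟨r', hr'⟩ := hf _ minor_135_mem_ID
  obtain ⟨n, hn⟩ := exists_eq_of_det_pow_mul hF hker 3
    (g := f - (φ (C a) * φ (Xs 0) + φ (C b) * φ (Xs 1) + φ (C c) * φ (Xs 2)))
    (m := m + r₀) (r := r' - (a * Z 0 + b * Z 1 + c * Z 2))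
    (by
      simp only [map_add]
      linear_combination hmq + e₀)
    (by
      simp only [map_add, map_sub, map_mul, ← hr', ← hZ]
      ring)
  refine ⟨C n + (C a * Xs 0 + C b * Xs 1 + C c * Xs 2), ?_⟩
  simp only [map_add, map_mul, ← hn]
  ring

end Field

/-! ### The rescaling of `L136` and `L245` -/

/-- The endomorphism of `S_G` that multiplies `L136` and `L245` by a scalar. -/
noncomputable def rescaleBy (c : ℂ) : SG →ₐ[ℂ] SG :=
  aeval fun
    | .L136 => C c * Xg .L136
    | .L245 => C c * Xg .L245
    | x => X x

/-- The endomorphism of `S̃_G` that multiplies `L136` and `L245` by a scalar. -/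
noncomputable def rescaleByN (c : ℂ) : SN →ₐ[ℂ] SN :=
  aeval fun
    | .L136 => C c * Xn .L136
    | .L245 => C c * Xn .L245
    | x => X x

theorem rescale_eq : rescale = rescaleBy 3 := by
  refine MvPolynomial.algHom_ext fun i => ?_
  have h3 : (C 3 : SG) = 3 := map_ofNat C 3
  cases i <;> simp [rescale, rescaleBy, h3]

theorem rescaleBy_comp {c d : ℂ} (hcd : c * d = 1) (a : SG) : rescaleBy c (rescaleBy d a) = a := by
  have : (rescaleBy c).comp (rescaleBy d) = AlgHom.id ℂ SG := by
    refine MvPolynomial.algHom_ext fun i => ?_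
    have key : ∀ x : SG, C d * (C c * x) = x := fun x => by
      rw [← mul_assoc, ← C_mul, mul_comm d, hcd, C_1, one_mul]
    have hC : rescaleBy c (C d) = C d := (rescaleBy c).commutes d
    cases i
    case L136 => simpa [rescaleBy] using key _
    case L245 => simpa [rescaleBy] using key _
    all_goals simp [rescaleBy]
  exact DFunLike.congr_fun this a

theorem h_rescaleBy (c : ℂ) (a : SG) : h (rescaleBy c a) = rescaleByN c (h a) := by
  have : h.comp (rescaleBy c) = (rescaleByN c).comp h := by
    refine MvPolynomial.algHom_ext fun i => ?_
    have hC : h (C c) = C c := h.commutes c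
    cases i <;> simp [rescaleBy, rescaleByN, h]
  exact DFunLike.congr_fun this a

theorem rescaleBy_mem_ID (c : ℂ) {a : SG} (ha : a ∈ ID) : rescaleBy c a ∈ ID := by
  rw [ID, RingHom.mem_ker, h_rescaleBy, RingHom.mem_ker.1 ha, map_zero]

theorem rescale_G' : rescale G' = G := by
  rw [G', ← AlgHom.coe_toRingHom, map_polyG', polyG'_eq, G, polyG]
  simp [rescale]

theorem G'_dvd_of_G_dvd {a : SG} (ha : G ∣ rescale a) : G' ∣ a := by
  obtain ⟨b, hb⟩ := ha
  rw [← rescale_G', rescale_eq] at hb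
  have hinv : (3⁻¹ : ℂ) * 3 = 1 := by norm_num
  refine ⟨rescaleBy 3⁻¹ b, ?_⟩
  rw [← rescaleBy_comp hinv a, hb, map_mul, rescaleBy_comp hinv]

/-! ### The isomorphism -/

theorem isDomain_RG : IsDomain RG := by
  have : (Ideal.span {G}).IsPrime := (Ideal.span_singleton_prime prime_G.ne_zero).2 prime_G
  exact Ideal.Quotient.isDomain _

/-- The map `S_G → Q_G` that is the quotient map up to the rescaling of `L136` and `L245`. -/
noncomputable def toQG : SG →+* QG :=
  (algebraMap RG QG).comp ((Ideal.Quotient.mk (Ideal.span {G})).comp (rescale : SG →+* SG))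

theorem toQG_apply (a : SG) :
    toQG a = algebraMap RG QG (Ideal.Quotient.mk (Ideal.span {G}) (rescale a)) := rfl

theorem toQG_eq_zero {a : SG} : toQG a = 0 ↔ G' ∣ a := by
  rw [toQG_apply, FaithfulSMul.algebraMap_eq_zero_iff, Ideal.Quotient.eq_zero_iff_mem,
    Ideal.mem_span_singleton]
  refine ⟨G'_dvd_of_G_dvd, ?_⟩
  rintro ⟨b, rfl⟩
  rw [map_mul, rescale_G']
  exact dvd_mul_right _ _

theorem exists_toQG_eq (r : RG) : ∃ a, toQG a = algebraMap RG QG r := by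
  obtain ⟨b, rfl⟩ := Ideal.Quotient.mk_surjective r
  refine ⟨rescaleBy 3⁻¹ b, ?_⟩
  rw [toQG_apply, rescale_eq, rescaleBy_comp (by norm_num)]

theorem exists_toQG_polyF_eq_zero : ∃ s : Fin 3 → QG, ∀ i,
    polyF (toQG (Xg .p1)) (toQG (Xg .p2)) (toQG (Xg .p3)) (toQG (Xg .p4)) (toQG (Xg .u))
      (toQG (Xg .v)) (toQG (Xg .t1)) (toQG (Xg .t2)) (toQG (Xg .L123)) (toQG (Xg .L124)) (toQG (Xg .L125))
      (toQG (Xg .L126)) (toQG (Xg .L135)) (toQG (Xg .L136)) (toQG (Xg .L245)) (toQG (Xg .L246))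
      (s 0) (s 1) (s 2) i = 0 := by
  have := isDomain_RG
  refine exists_polyF_eq_zero (K := QG) _ _ _ _ _ _ _ _ _ _ _ _ _ _ _ _ ?_ ?_ ?_
  · rw [← map_polyG' toQG]
    exact toQG_eq_zero.2 dvd_rfl
  · rw [← map_mul, ← map_mul, ← map_sub]
    exact fun h0 => not_G'_dvd_det (toQG_eq_zero.1 h0)
  · rw [← map_minor_matM toQG]
    exact fun h0 => not_G'_dvd_minor_123 (toQG_eq_zero.1 h0)

/-- The homomorphism `S_Π → Q_G` with kernel `I_Π` and image `R_G[J_D⁻¹]`. -/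
theorem exists_hom : ∃ φ : SPi →+* QG, (∀ a, φ (C a) = toQG a) ∧ RingHom.ker φ = IPi ∧
    ∀ y, y ∈ unprojRing ↔ ∃ g, φ g = y := by
  have := isDomain_RG
  obtain ⟨s, hs⟩ := exists_toQG_polyF_eq_zero
  set φ : SPi →+* QG := eval₂Hom toQG s with hφ
  have hC : ∀ a, φ (C a) = toQG a := fun a => eval₂Hom_C _ _ _
  have hX : ∀ j, φ (Xs j) = s j := fun j => eval₂Hom_X' _ _ _
  have hF : ∀ i, φ (F i) = 0 := by
    intro i
    rw [← hs i, F, map_polyF]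
    simp only [hC, hX]
  have hker : ∀ a, φ (C a) = 0 → G' ∣ a := fun a ha => toQG_eq_zero.1 (hC a ▸ ha)
  refine ⟨φ, hC, ker_eq_IPi (K := QG) hF hker, fun y => ⟨fun hy => ?_, ?_⟩⟩
  · refine Algebra.adjoin_induction (fun f hf => ?_) (fun r => ?_) (fun x y _ _ hx hy => ?_)
      (fun x y _ _ hx hy => ?_) hy
    · refine exists_map_eq_of_mul_mem (K := QG) hF hker fun a ha => ?_
      obtain ⟨r, hr⟩ := hf (Ideal.Quotient.mk _ (rescale a))
        (Ideal.mem_map_of_mem _ (rescale_eq ▸ rescaleBy_mem_ID 3 ha))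
      obtain ⟨b, hb⟩ := exists_toQG_eq r
      exact ⟨b, by rw [hC, hC, toQG_apply a, ← hr, hb]⟩
    · obtain ⟨b, hb⟩ := exists_toQG_eq r
      exact ⟨C b, by rw [hC, hb]⟩
    · obtain ⟨g, rfl⟩ := hx
      obtain ⟨g', rfl⟩ := hy
      exact ⟨g + g', map_add _ _ _⟩
    · obtain ⟨g, rfl⟩ := hx
      obtain ⟨g', rfl⟩ := hy
      exact ⟨g * g', map_mul _ _ _⟩
  · rintro ⟨g, rfl⟩
    induction g using MvPolynomial.induction_on with
    | C a => exact hC a ▸ unprojRing.algebraMap_mem _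
    | add p q hp hq => exact map_add φ p q ▸ add_mem hp hq
    | mul_X p j hp =>
      rw [map_mul]
      refine mul_mem hp (Algebra.subset_adjoin fun y hy => ?_)
      obtain ⟨x, hx, rfl⟩ := (Ideal.mem_map_iff_of_surjective _ Ideal.Quotient.mk_surjective).1 hy
      obtain ⟨Y, hY, -, -⟩ := exists_mul_X (K := QG) hF hker (rescaleBy_mem_ID 3⁻¹ hx)
      refine ⟨Ideal.Quotient.mk _ (rescale (Y j)), ?_⟩
      rw [← toQG_apply, ← hC, ← hY, hC, toQG_apply, rescale_eq, rescaleBy_comp (by norm_num),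
        mul_comm]

end Unproj

theorem proposition3p1 :
    IsDomain Unproj.RG ∧
    (∃ e : Unproj.RPi ≃ₐ[ℂ] Unproj.unprojRing, ∀ f : Unproj.SG,
      e (Ideal.Quotient.mk Unproj.IPi (MvPolynomial.C f)) =
        algebraMap Unproj.RG Unproj.unprojRing
          (Ideal.Quotient.mk (Ideal.span {Unproj.G}) (Unproj.rescale f))) ∧
    IsDomain Unproj.RPi := by
  have := Unproj.isDomain_RG
  obtain ⟨φ, hC, hker, hrange⟩ := Unproj.exists_hom
  have hprime : Unproj.IPi.IsPrime := hker ▸ RingHom.ker_isPrime φ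
  refine ⟨this, ?_, Ideal.Quotient.isDomain _⟩
  let ψ : Unproj.SPi →+* Unproj.unprojRing :=
    φ.codRestrict Unproj.unprojRing fun g => (hrange _).2 ⟨g, rfl⟩
  have hψ : ∀ g, (ψ g : Unproj.QG) = φ g := fun g => rfl
  have hψker : ∀ g, ψ g = 0 ↔ g ∈ Unproj.IPi := fun g => by
    rw [← hker, RingHom.mem_ker, ← hψ, ZeroMemClass.coe_eq_zero]
  let e : Unproj.RPi →+* Unproj.unprojRing :=
    Ideal.Quotient.lift Unproj.IPi ψ fun g hg => (hψker g).2 hg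
  have he : ∀ f : Unproj.SG, e (Ideal.Quotient.mk Unproj.IPi (MvPolynomial.C f)) =
      algebraMap Unproj.RG Unproj.unprojRing
        (Ideal.Quotient.mk (Ideal.span {Unproj.G}) (Unproj.rescale f)) := fun f =>
    Subtype.ext (hC f)
  have hbij : Function.Bijective e := by
    constructor
    · refine (injective_iff_map_eq_zero e).2 fun a ha => ?_
      obtain ⟨g, rfl⟩ := Ideal.Quotient.mk_surjective a
      exact Ideal.Quotient.eq_zero_iff_mem.2 ((hψker g).1 ha)
    · rintro ⟨y, hy⟩
      obtain ⟨g, rfl⟩ := (hrange y).1 hy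
      exact ⟨Ideal.Quotient.mk _ g, rfl⟩
  refine ⟨AlgEquiv.ofRingEquiv (f := RingEquiv.ofBijective e hbij) fun r => ?_, he⟩
  have h1 : algebraMap ℂ Unproj.RPi r = Ideal.Quotient.mk Unproj.IPi (.C (.C r)) := rfl
  have h2 : Unproj.rescale (.C r) = .C r := Unproj.rescale.commutes r
  rw [h1, RingEquiv.ofBijective_apply, he, h2]
  rfl
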